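/- Let $\mathcal O_\infty$ be the Cuntz algebra with canonical generators $s_1,s_2,\dots$, i.e. the C*-algebra generated by elements with $s_i^*s_j=\delta_{ij}I$, $\sum_{i\le k}s_is_i^*\le I$ for all $k$. Let $\mathcal B$ be the unital complex $*$-algebra generated by $a_n$ $(n\ge 1)$ with $a_na_m^*-a_m^*a_n=\delta_{nm}I$ and $a_na_m-a_ma_n=a_n^*a_m^*-a_m^*a_n^*=0$. A $*$-representation $\eta$ of $\mathcal B$ on a subspace $D$ of a Hilbert space is a unital homomorphism from $\mathcal B$ to the linear endomorphisms of $D$ with $\langle \eta(x)v,w\rangle=\langle v,\eta(x^*)w\rangle$ for $v,w\in D$; its Hilbert space is $\overline D$. A vector $\Omega\in D$ is cyclic for $\eta$ if $\eta(\mathcal B)\Omega=D$. We call $\eta$ the Fock representation with vacuum $\Omega$ if $\Omega\neq0$ is cyclic and $\eta(a_n)\Omega=0$ for all $n$; irreducible if the only bounded operators $T$ on $\overline D$ with $\langle w,T\eta(x)v\rangle=\langle\eta(x^*)w,Tv\rangle$ for all $x\in\mathcal B$, $v,w\in D$ are the scalars. Two $*$-representations are unitarily equivalent if some unitary between their Hilbert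 spaces maps one domain onto the other and intertwines the actions. A representation $(\mathcal H,\pi)$ of $\mathcal O_\infty$ is permutative if there are a complete orthonormal basis $\{e_\lambda\}_{\lambda\in\Lambda}$ of $\mathcal H$ (a reference basis) and maps $f_i:\Lambda\to\Lambda$ with $\pi(s_i)e_\lambda=e_{f_i(\lambda)}$ for all $i,\lambda$; the linear hull of $\{e_\lambda\}$ is called a reference subspace. Put $$A_1v=\sum_{m\ge1}\sqrt m\,\pi(s_ms_{m+1}^*)v,\qquad A_{n}v=\sum_{m\ge1}\pi(s_m)A_{n-1}\pi(s_m^*)v\quad(n\ge2)$$ for $v$ in a reference subspace $D$ (all sums are then finite). A $*$-representation $\eta$ of $\mathcal B$ on $D$ with $\eta(a_n)=A_n$ for all $n$ is called the restriction of $\pi$ on $\mathcal B$ (with domain $D$). **Theorem.** (i) Let $j\ge1$ and let $(\mathcal H,\pi_j)$ be a representation of $\mathcal O_\infty$ with a nonzero cyclic vector $\Omega$ such that $\pi_j(s_j)\Omega=\Omega$. Then $\pi_j$ is permutative, and for each reference subspace $D_j$: $D_j$ is dense in $\mathcal H$, the restriction $\eta_j$ of $\pi_j$ on $\mathcal B$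 with domain $D_j$ exists and is unique, $\Omega\in D_j$, $\eta_j(\mathcal B)\Omega=D_j$, and $\eta_j(a_na_n^*)\Omega=j\Omega$ for all $n\ge1$. In particular $\eta_1$ is the Fock representation of $\mathcal B$ with the vacuum $\Omega$. (ii) Let $(\mathcal H,\pi_{12})$ be a representation of $\mathcal O_\infty$ with a nonzero cyclic vector $\Omega$ such that $\pi_{12}(s_1s_2)\Omega=\Omega$, and let $\Omega'=\pi_{12}(s_2)\Omega$. Then $\pi_{12}$ is permutative, and for each reference subspace $D$: $D$ is dense in $\mathcal H$, the restriction $\theta$ of $\pi_{12}$ on $\mathcal B$ with domain $D$ exists and is unique, and $D=V_1\oplus V_2$ for two orthogonal subspaces carrying subrepresentations $\eta_{12}$ (on $V_1$) and $\eta_{21}$ (on $V_2$) of $\theta$ with $V_1=\eta_{12}(\mathcal B)\Omega$, $V_2=\eta_{21}(\mathcal B)\Omega'$ and, for all $n\ge1$, $$\eta_{12}(a_{2n-1})\Omega=0,\quad \eta_{21}(a_{2n})\Omega'=0,\quad \eta_{12}(a_{2n}^*a_{2n})\Omega=\Omega,\quad \eta_{21}(a_{2n-1}^*a_{2n-1})\Omega'=\Omega'.$$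 (iii) Any two of the representations $\eta_j$ $(j\ge1)$, $\eta_{12}$, $\eta_{21}$ of $\mathcal B$ with different names, obtained as above from any representations of $\mathcal O_\infty$ of the kinds in (i), (ii), are not unitarily equivalent. (iv) All the representations $\eta_j$ $(j\ge1)$, $\eta_{12}$, $\eta_{21}$ of $\mathcal B$ so obtained are irreducible. -/

import Mathlib

universe u

/-! ## The `*`-algebra of bosons

The positive integers `{1, 2, 3, …}` are `ℕ+` throughout. -/

/-- Free generators: `a n` stands for `aₙ` and `adag n` for `aₙ*`. -/
inductive BosonGen : Type
  | a (n : ℕ+)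
  | adag (n : ℕ+)

/-- The canonical commutation relations
`aₙ aₘ* - aₘ* aₙ = δₙₘ`, `aₙ aₘ - aₘ aₙ = 0`, `aₙ* aₘ* - aₘ* aₙ* = 0`. -/
inductive BosonRel : FreeAlgebra ℂ BosonGen → FreeAlgebra ℂ BosonGen → Prop
  | mixed (n m : ℕ+) : BosonRel
      (FreeAlgebra.ι ℂ (.a n) * FreeAlgebra.ι ℂ (.adag m)
        - FreeAlgebra.ι ℂ (.adag m) * FreeAlgebra.ι ℂ (.a n)) (if n = m then 1 else 0)
  | annihilation (n m : ℕ+) : BosonRel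
      (FreeAlgebra.ι ℂ (.a n) * FreeAlgebra.ι ℂ (.a m)
        - FreeAlgebra.ι ℂ (.a m) * FreeAlgebra.ι ℂ (.a n)) 0
  | creation (n m : ℕ+) : BosonRel
      (FreeAlgebra.ι ℂ (.adag n) * FreeAlgebra.ι ℂ (.adag m)
        - FreeAlgebra.ι ℂ (.adag m) * FreeAlgebra.ι ℂ (.adag n)) 0

/-- The algebra `𝓑` of bosons: the unital complex algebra generated by `aₙ`, `aₙ*` (`n ≥ 1`)
subject to the canonical commutation relations. Its involution is constructed below. -/
def BosonAlgebra : Type := RingQuot BosonRel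

namespace BosonAlgebra

noncomputable instance : Ring BosonAlgebra := inferInstanceAs (Ring (RingQuot BosonRel))

noncomputable instance : Algebra ℂ BosonAlgebra :=
  inferInstanceAs (Algebra ℂ (RingQuot BosonRel))

/-- The quotient map from the free algebra. -/
noncomputable def mk : FreeAlgebra ℂ BosonGen →ₐ[ℂ] BosonAlgebra :=
  RingQuot.mkAlgHom ℂ BosonRel

/-- The image in `𝓑` of a free generator. -/
noncomputable def gen (g : BosonGen) : BosonAlgebra := mk (FreeAlgebra.ι ℂ g)

/-- The annihilation operator `aₙ ∈ 𝓑`. Its adjoint `aₙ*` is `star (a n)`. -/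
noncomputable def a (n : ℕ+) : BosonAlgebra := gen (.a n)

theorem mk_rel {x y : FreeAlgebra ℂ BosonGen} (h : BosonRel x y) : mk x = mk y :=
  RingQuot.mkAlgHom_rel ℂ h

theorem induction {P : BosonAlgebra → Prop} (hg : ∀ g, P (gen g))
    (hs : ∀ c : ℂ, P (algebraMap ℂ _ c)) (hm : ∀ x y, P x → P y → P (x * y))
    (ha : ∀ x y, P x → P y → P (x + y)) (x : BosonAlgebra) : P x := by
  obtain ⟨y, rfl⟩ := RingQuot.mkAlgHom_surjective ℂ BosonRel x
  change P (mk y)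
  induction y using FreeAlgebra.induction with
  | grade0 r => rw [AlgHom.commutes]; exact hs r
  | grade1 g => exact hg g
  | mul x y hx hy => rw [map_mul]; exact hm _ _ hx hy
  | add x y hx hy => rw [map_add]; exact ha _ _ hx hy

/-- Exchange of `aₙ` and `aₙ*`. -/
def genStar : BosonGen → BosonGen
  | .a n => .adag n
  | .adag n => .a n

/-- The opposite algebra of `𝓑` with complex conjugate scalars, the target of the involution
regarded as a homomorphism of complex algebras. -/
def ConjOp : Type := BosonAlgebraᵐᵒᵖ

noncomputable instance : Ring ConjOp := inferInstanceAs (Ring BosonAlgebraᵐᵒᵖ)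

noncomputable instance : Algebra ℂ ConjOp :=
  Algebra.compHom BosonAlgebraᵐᵒᵖ (starRingEnd ℂ)

/-- `aₙ ↦ aₙ*`, `aₙ* ↦ aₙ`, with values in the conjugate opposite algebra. -/
noncomputable def genOp (g : BosonGen) : ConjOp := MulOpposite.op (gen (genStar g))

/-- The involution as a homomorphism into `ConjOp`. -/
noncomputable def starHom : BosonAlgebra →ₐ[ℂ] ConjOp :=
  RingQuot.liftAlgHom ℂ ⟨FreeAlgebra.lift ℂ genOp, by
    intro x y h
    cases h with
    | mixed n m =>
      simp only [map_sub, map_mul, FreeAlgebra.lift_ι_apply]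
      have h := mk_rel (BosonRel.mixed m n)
      simp only [map_sub, map_mul] at h
      refine Eq.trans (congrArg MulOpposite.op h) ?_
      by_cases hnm : n = m
      · subst hnm; simp only [if_true, map_one]; rfl
      · simp only [if_neg hnm, if_neg (Ne.symm hnm), map_zero]; rfl
    | annihilation n m =>
      simp only [map_sub, map_mul, FreeAlgebra.lift_ι_apply, map_zero]
      have h := mk_rel (BosonRel.creation m n)
      simp only [map_sub, map_mul, map_zero] at h
      exact congrArg MulOpposite.op h
    | creation n m =>
      simp only [map_sub, map_mul, FreeAlgebra.lift_ι_apply, map_zero]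
      have h := mk_rel (BosonRel.annihilation m n)
      simp only [map_sub, map_mul, map_zero] at h
      exact congrArg MulOpposite.op h⟩

theorem starHom_gen (g : BosonGen) : starHom (gen g) = genOp g :=
  (RingQuot.liftAlgHom_mkAlgHom_apply ℂ _ _ (FreeAlgebra.ι ℂ g)).trans
    (FreeAlgebra.lift_ι_apply _ _)

/-- The involution of `𝓑`: the conjugate-linear anti-automorphism that exchanges `aₙ`
and `aₙ*`. -/
noncomputable instance : Star BosonAlgebra := ⟨fun x => MulOpposite.unop (starHom x)⟩

theorem star_gen (g : BosonGen) : star (gen g) = gen (genStar g) := by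
  exact congrArg MulOpposite.unop (starHom_gen g)

theorem star_algebraMap (c : ℂ) :
    star (algebraMap ℂ BosonAlgebra c) = algebraMap ℂ BosonAlgebra (starRingEnd ℂ c) := by
  change MulOpposite.unop (starHom _) = _
  rw [AlgHom.commutes]
  rfl

theorem star_mul_aux (x y : BosonAlgebra) : star (x * y) = star y * star x := by
  change MulOpposite.unop (starHom _) = _
  rw [map_mul]; rfl

theorem star_add_aux (x y : BosonAlgebra) : star (x + y) = star x + star y := by
  change MulOpposite.unop (starHom _) = _
  rw [map_add]; rfl

noncomputable instance : StarRing BosonAlgebra where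
  star_involutive x := by
    induction x using BosonAlgebra.induction with
    | hg g => rw [star_gen, star_gen]; cases g <;> rfl
    | hs c => rw [star_algebraMap, star_algebraMap, Complex.conj_conj]
    | hm x y hx hy => rw [star_mul_aux, star_mul_aux, hx, hy]
    | ha x y hx hy => rw [star_add_aux, star_add_aux, hx, hy]
  star_mul := star_mul_aux
  star_add := star_add_aux

instance : StarModule ℂ BosonAlgebra where
  star_smul c x := by
    rw [Algebra.smul_def, star_mul, star_algebraMap, Algebra.smul_def]
    exact (Algebra.commutes _ _).symm

theorem star_a (n : ℕ+) : star (a n) = gen (.adag n) := star_gen _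

end BosonAlgebra

/-! ## Representations of the boson algebra -/

section BosonRepresentations

variable {H : Type*} [NormedAddCommGroup H] [InnerProductSpace ℂ H]
variable {H' : Type*} [NormedAddCommGroup H'] [InnerProductSpace ℂ H']

/-- A `*`-representation of `𝓑` by (in general unbounded) operators whose common invariant
domain is the subspace `D` of `H`: a unital homomorphism `toHom` from `𝓑` to the linear
endomorphisms of `D` with `⟨x v, w⟩ = ⟨v, x* w⟩` on `D`. Its Hilbert space is the closure
of `D` in `H`. -/
@[ext]
structure BosonAction (D : Submodule ℂ H) where
  toHom : BosonAlgebra →ₐ[ℂ] Module.End ℂ D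
  adjoint_eq : ∀ (x : BosonAlgebra) (v w : D),
    inner ℂ (toHom x v) w = inner ℂ v (toHom (star x) w)

namespace BosonAction

/-- `Ω` is a cyclic vector: `η(𝓑)Ω` is the whole domain `D`. -/
def IsCyclicVector {D : Submodule ℂ H} (η : BosonAction D) (Ω : D) : Prop :=
  ∀ v : D, ∃ x : BosonAlgebra, η.toHom x Ω = v

/-- `η` is the Fock representation with vacuum `Ω`: the nonzero vector `Ω` is cyclic and
annihilated by all `aₙ`. -/
def IsFock {D : Submodule ℂ H} (η : BosonAction D) (Ω : D) : Prop :=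
  Ω ≠ 0 ∧ η.IsCyclicVector Ω ∧ ∀ n : ℕ+, η.toHom (BosonAlgebra.a n) Ω = 0

/-- `η`, acting on `V`, is a subrepresentation of `θ`, acting on `D`. -/
def IsSubaction {V D : Submodule ℂ H} (η : BosonAction V) (θ : BosonAction D) : Prop :=
  ∃ h : V ≤ D, ∀ (x : BosonAlgebra) (v : V),
    ((η.toHom x v : V) : H) = (θ.toHom x (Submodule.inclusion h v) : D)

/-- The inclusion of the domain `D` into the Hilbert space of the representation. -/
def incl (D : Submodule ℂ H) : D →ₗ[ℂ] D.topologicalClosure :=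
  Submodule.inclusion D.le_topologicalClosure

/-- The commutant of `η(𝓑)` in the bounded operators on the closure of `D`: all bounded `T`
with `⟨w, T x v⟩ = ⟨x* w, T v⟩` for `v, w ∈ D` and `x ∈ 𝓑` (the weak commutant; a bounded
operator that preserves `D` belongs to it exactly if it commutes with each `x` on `D`). -/
def commutant {D : Submodule ℂ H} (η : BosonAction D) :
    Set (D.topologicalClosure →L[ℂ] D.topologicalClosure) :=
  {T | ∀ (x : BosonAlgebra) (v w : D),
    inner ℂ (incl D w) (T (incl D (η.toHom x v)))
      = inner ℂ (incl D (η.toHom (star x) w)) (T (incl D v))}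

/-- `η` is irreducible: its commutant consists of the scalar multiples of the identity. -/
def IsIrreducible {D : Submodule ℂ H} (η : BosonAction D) : Prop :=
  η.commutant = Set.range fun c : ℂ => c • ContinuousLinearMap.id ℂ D.topologicalClosure

/-- Unitary equivalence: a surjective linear isometry between the domains which intertwines
the actions. Such a map is the same as a unitary between the Hilbert spaces (the closures of
the domains) which carries one domain onto the other and intertwines the actions. -/
def UnitarilyEquivalent {D : Submodule ℂ H} {D' : Submodule ℂ H'}
    (η : BosonAction D) (η' : BosonAction D') : Prop :=
  ∃ U : D ≃ₗᵢ[ℂ] D', ∀ (x : BosonAlgebra) (v : D), U (η.toHom x v) = η'.toHom x (U v)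

end BosonAction

end BosonRepresentations

/-! ## The Cuntz algebra and its permutative representations -/

/-- `s₁, s₂, …` are canonical generators of the Cuntz algebra `O = 𝓞_∞`: they satisfy
`sᵢ* sⱼ = δᵢⱼ I` and generate `O` as a C*-algebra. The elements `sᵢ sᵢ*` are then mutually
orthogonal projections, so that `∑ i ≤ k, sᵢ sᵢ* ≤ I` for all `k` holds automatically. -/
structure IsCuntzGenerators {O : Type*} [CStarAlgebra O] (s : ℕ+ → O) : Prop where
  star_mul : ∀ i j, star (s i) * s j = if i = j then 1 else 0
  generates : (StarAlgebra.adjoin ℂ (Set.range s)).topologicalClosure = ⊤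

section Cuntz

variable {O : Type*} [CStarAlgebra O]
variable {H : Type u} [NormedAddCommGroup H] [InnerProductSpace ℂ H] [CompleteSpace H]

/-- `Ω` is a (nonzero) cyclic vector of `(H, π)` with `π(x)Ω = Ω`. -/
def IsCyclicFixed (π : O →⋆ₐ[ℂ] (H →L[ℂ] H)) (x : O) (Ω : H) : Prop :=
  Ω ≠ 0 ∧ Dense (Set.range fun y : O => π y Ω) ∧ π x Ω = Ω

/-- `D` is a reference subspace of `(H, π)`: the linear hull of a complete orthonormal basis
`e` on which every `π(sᵢ)` acts by `π(sᵢ) eₙ = e_{fᵢ(n)}` for a map `fᵢ` of the index set. -/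
def IsReferenceSubspace (s : ℕ+ → O) (π : O →⋆ₐ[ℂ] (H →L[ℂ] H)) (D : Submodule ℂ H) : Prop :=
  ∃ (Λ : Type u) (e : HilbertBasis Λ ℂ H) (f : ℕ+ → Λ → Λ),
    (∀ i n, π (s i) (e n) = e (f i n)) ∧ D = Submodule.span ℂ (Set.range e)

/-- `(H, π)` is a permutative representation. -/
def IsPermutative (s : ℕ+ → O) (π : O →⋆ₐ[ℂ] (H →L[ℂ] H)) : Prop :=
  ∃ D : Submodule ℂ H, IsReferenceSubspace s π D

/-! ### The recursive boson system

The series below are only used on a reference subspace, where all but finitely many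
terms vanish. -/

/-- `A₁ v = ∑ₘ √m tₘ tₘ₊₁* v`. -/
noncomputable def rbsOne (t : ℕ+ → H →L[ℂ] H) (v : H) : H :=
  ∑' m : ℕ+, ((Real.sqrt (m : ℝ) : ℝ) : ℂ) • t m (star (t (m + 1)) v)

/-- `ρ(T) v = ∑ₘ tₘ T tₘ* v`. -/
noncomputable def rbsRho (t : ℕ+ → H →L[ℂ] H) (T : H → H) (v : H) : H :=
  ∑' m : ℕ+, t m (T (star (t m) v))

/-- The recursive boson system: `A₁` as above and `Aₙ = ρ(Aₙ₋₁)` for `n ≥ 2`. -/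
noncomputable def rbs (t : ℕ+ → H →L[ℂ] H) (n : ℕ+) : H → H :=
  (rbsRho t)^[(n : ℕ) - 1] (rbsOne t)

/-- `η` is the restriction of `(H, π)` on `𝓑` with the domain `D`: each `aₙ` acts on `D` as
the operator `Aₙ` of the recursive boson system of `π`. -/
def IsRestriction (s : ℕ+ → O) (π : O →⋆ₐ[ℂ] (H →L[ℂ] H)) {D : Submodule ℂ H}
    (η : BosonAction D) : Prop :=
  ∀ (n : ℕ+) (v : D),
    ((η.toHom (BosonAlgebra.a n) v : D) : H) = rbs (fun m => π (s m)) n v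

/-- Names of the representations `η_j` (`j ≥ 1`), `η₁₂` and `η₂₁`. -/
inductive EtaLabel : Type
  | single (j : ℕ+)
  | onetwo
  | twoone

/-- `η` is the representation of `𝓑` with the given name:
* `η_j` is the restriction, on a reference subspace, of a representation of `O` with a cyclic
  vector `Ω` such that `s_j Ω = Ω`;
* `η₁₂` and `η₂₁` are the subrepresentations, on the cyclic subspaces of `Ω` and of `s₂ Ω`, of
  the restriction, on a reference subspace, of a representation of `O` with a cyclic vector
  `Ω` such that `s₁ s₂ Ω = Ω`. -/
def IsEta (s : ℕ+ → O) (X : EtaLabel) {V : Submodule ℂ H} (η : BosonAction V) : Prop :=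
  match X with
  | .single j => ∃ (π : O →⋆ₐ[ℂ] (H →L[ℂ] H)) (Ω : H), IsCyclicFixed π (s j) Ω ∧
      IsReferenceSubspace s π V ∧ IsRestriction s π η
  | .onetwo => ∃ (π : O →⋆ₐ[ℂ] (H →L[ℂ] H)) (Ω : H), IsCyclicFixed π (s 1 * s 2) Ω ∧
      ∃ (D : Submodule ℂ H) (θ : BosonAction D), IsReferenceSubspace s π D ∧
        IsRestriction s π θ ∧ η.IsSubaction θ ∧ ∃ h : Ω ∈ V, η.IsCyclicVector ⟨Ω, h⟩
  | .twoone => ∃ (π : O →⋆ₐ[ℂ] (H →L[ℂ] H)) (Ω : H), IsCyclicFixed π (s 1 * s 2) Ω ∧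
      ∃ (D : Submodule ℂ H) (θ : BosonAction D), IsReferenceSubspace s π D ∧
        IsRestriction s π θ ∧ η.IsSubaction θ ∧
        ∃ h : π (s 2) Ω ∈ V, η.IsCyclicVector ⟨π (s 2) Ω, h⟩

end Cuntz

/-!
A vector of a permutative representation is labelled by the word of letters that the isometries
`sₘ*` strip from it. The basis vectors are thus indexed by infinite words `m₁m₂m₃…`; recording the
letter `m` as the number `m - 1` turns a word into a sequence `x : ℕ → ℕ`. In a family `b` with
`sₘ b(x) = b(m, x)` (`IsCodedFamily`), distinct members are automatically orthogonal, the norm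
depends only on the tail of `x`, and the recursive boson system acts as in the occupation number
representation: `Aₙ b(x) = √xₙ b(x - δₙ)`, where the mode `n` is the position `n - 1` of the sequence
(`IsCodedFamily.rbs_linearCombination`). Hence the boson algebra acts on the span of `b`. To construct this action without choosing a basis, the operators
are defined on formal combinations of sequences, where the commutation relations are checked, and
are pushed to the span; the kernel of the projection is invariant because the formal operators
respect adjoints (`IsOccupationFamily.exists_bosonAction`).

A vector fixed by `s_j` or `s₁s₂` gives a coded family supported on the words that end in `jjj…`
or in `1212…` (`exists_isCodedFamily`). If it is cyclic, the span of the family is dense. Every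
reference subspace is then equal to this span (`IsReferenceSubspace.eq_span`): a reference basis
vector not orthogonal to `b(x)` must share all letters with `x`, so it is orthogonal to all other
`b(y)` and therefore a multiple of `b(x)`.

The boson algebra changes only finitely many occupation numbers, and it reaches every such change.
So the span splits into cyclic pieces, one for each class of sequences with a common tail:
one class for `jjj…`, and two for `1212…`, according to the parity. Within a piece the joint
eigenspaces of the number operators `aₙ* aₙ` are lines, with the sequences of the class as
eigenvalues. A member of the commutant preserves the line of the generating vector and is then a
scalar by cyclicity (`IsTailAction.isIrreducible`), while a unitary equivalence would carry joint
eigenvalues to joint eigenvalues, which is impossible for different classes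
(`IsTailAction.not_unitarilyEquivalent`).
-/

open scoped InnerProductSpace

/-! ### Sequences of occupation numbers -/

/-- The sequence `i, x 0, x 1, …`. -/
def consSeq (i : ℕ) (x : ℕ → ℕ) : ℕ → ℕ
  | 0 => i
  | n + 1 => x n

/-- The sequence `x 1, x 2, …`. -/
def shiftSeq (x : ℕ → ℕ) : ℕ → ℕ := fun n => x (n + 1)

@[simp] theorem consSeq_zero (i : ℕ) (x : ℕ → ℕ) : consSeq i x 0 = i := rfl

@[simp] theorem consSeq_succ (i : ℕ) (x : ℕ → ℕ) (n : ℕ) : consSeq i x (n + 1) = x n := rfl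

@[simp] theorem shiftSeq_apply (x : ℕ → ℕ) (n : ℕ) : shiftSeq x n = x (n + 1) := rfl

theorem consSeq_shiftSeq (x : ℕ → ℕ) : consSeq (x 0) (shiftSeq x) = x := by
  funext n; cases n <;> rfl

theorem update_zero_eq_consSeq (x : ℕ → ℕ) (k : ℕ) :
    Function.update x 0 k = consSeq k (shiftSeq x) := by
  funext n; cases n <;> simp

theorem update_succ_eq_consSeq (x : ℕ → ℕ) (n k : ℕ) :
    Function.update x (n + 1) k = consSeq (x 0) (Function.update (shiftSeq x) n k) := by
  funext m; cases m <;> simp [Function.update_apply]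

theorem shiftSeq_iterate_apply (N : ℕ) (x : ℕ → ℕ) (n : ℕ) :
    shiftSeq^[N] x n = x (n + N) := by
  induction N generalizing x with
  | zero => rfl
  | succ N ih => rw [Function.iterate_succ_apply, ih, shiftSeq_apply, add_assoc]

/-! ### Annihilation and creation operators on formal combinations of occupation sequences -/

/-- The vector space with basis all sequences of occupation numbers. It carries a formal action of
the boson algebra, of which the concrete ones below are images. -/
abbrev OccupationSpace : Type := (ℕ → ℕ) →₀ ℂ

/-- Annihilation in the mode `n`: `x ↦ √(x n) (x - δₙ)`. For `x n = 0` the truncated subtraction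
is harmless, because the coefficient vanishes. -/
noncomputable def lowerOp (n : ℕ) : Module.End ℂ OccupationSpace :=
  Finsupp.linearCombination ℂ fun x =>
    ((√(x n : ℝ) : ℝ) : ℂ) • Finsupp.single (Function.update x n (x n - 1)) (1 : ℂ)

/-- Creation in the mode `n`: `x ↦ √(x n + 1) (x + δₙ)`. -/
noncomputable def raiseOp (n : ℕ) : Module.End ℂ OccupationSpace :=
  Finsupp.linearCombination ℂ fun x =>
    ((√(x n + 1 : ℝ) : ℝ) : ℂ) • Finsupp.single (Function.update x n (x n + 1)) (1 : ℂ)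

theorem lowerOp_single (n : ℕ) (x : ℕ → ℕ) :
    lowerOp n (Finsupp.single x 1) =
      ((√(x n : ℝ) : ℝ) : ℂ) • Finsupp.single (Function.update x n (x n - 1)) (1 : ℂ) := by
  rw [lowerOp, Finsupp.linearCombination_single, one_smul]

theorem raiseOp_single (n : ℕ) (x : ℕ → ℕ) :
    raiseOp n (Finsupp.single x 1) =
      ((√(x n + 1 : ℝ) : ℝ) : ℂ) • Finsupp.single (Function.update x n (x n + 1)) (1 : ℂ) := by
  rw [raiseOp, Finsupp.linearCombination_single, one_smul]

theorem ofReal_sqrt_mul_self {r : ℝ} (hr : 0 ≤ r) : ((√r : ℝ) : ℂ) * ((√r : ℝ) : ℂ) = (r : ℂ) := by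
  rw [← Complex.ofReal_mul, Real.mul_self_sqrt hr]

theorem lowerOp_mul_raiseOp_single (n : ℕ) (x : ℕ → ℕ) :
    lowerOp n (raiseOp n (Finsupp.single x 1)) = ((x n : ℂ) + 1) • Finsupp.single x 1 := by
  rw [raiseOp_single, map_smul, lowerOp_single, smul_smul]
  have h := ofReal_sqrt_mul_self (r := (x n : ℝ) + 1) (by positivity)
  simp only [Function.update_self, Function.update_idem, Nat.add_sub_cancel,
    Function.update_eq_self]
  push_cast at h ⊢
  rw [h]

theorem raiseOp_mul_lowerOp_single (n : ℕ) (x : ℕ → ℕ) :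
    raiseOp n (lowerOp n (Finsupp.single x 1)) = (x n : ℂ) • Finsupp.single x 1 := by
  rw [lowerOp_single, map_smul, raiseOp_single, smul_smul]
  rcases Nat.eq_zero_or_pos (x n) with h0 | h0
  · simp [h0]
  · have h := ofReal_sqrt_mul_self (r := (x n : ℝ)) (by positivity)
    have h1 : ((x n - 1 : ℕ) : ℝ) + 1 = x n := by
      rw [Nat.cast_sub h0]; ring
    simp only [Function.update_self, Function.update_idem, Nat.sub_add_cancel h0,
      Function.update_eq_self, h1]
    rw [h, Complex.ofReal_natCast]

theorem lowerOp_raiseOp_commutator (n m : ℕ) :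
    lowerOp n * raiseOp m - raiseOp m * lowerOp n = if n = m then 1 else 0 := by
  refine Finsupp.lhom_ext' fun x => LinearMap.ext_ring ?_
  simp only [LinearMap.comp_apply, Finsupp.lsingle_apply, LinearMap.sub_apply, Module.End.mul_apply]
  by_cases h : n = m
  · subst h
    rw [lowerOp_mul_raiseOp_single, raiseOp_mul_lowerOp_single, if_pos rfl, Module.End.one_apply,
      ← sub_smul, add_sub_cancel_left, one_smul]
  · rw [if_neg h, raiseOp_single, lowerOp_single, map_smul, map_smul, lowerOp_single,
      raiseOp_single, smul_smul, smul_smul, Function.update_of_ne h, Function.update_of_ne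
      (Ne.symm h), Function.update_comm h, mul_comm, sub_self, LinearMap.zero_apply]

theorem lowerOp_commutator (n m : ℕ) : lowerOp n * lowerOp m - lowerOp m * lowerOp n = 0 := by
  refine Finsupp.lhom_ext' fun x => LinearMap.ext_ring ?_
  simp only [LinearMap.comp_apply, Finsupp.lsingle_apply, LinearMap.sub_apply, Module.End.mul_apply]
  by_cases h : n = m
  · rw [h, sub_self, LinearMap.zero_apply]
  · rw [lowerOp_single, lowerOp_single, map_smul, map_smul, lowerOp_single,
      lowerOp_single, smul_smul, smul_smul, Function.update_of_ne h, Function.update_of_ne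
      (Ne.symm h), Function.update_comm h, mul_comm, sub_self, LinearMap.zero_apply]

theorem raiseOp_commutator (n m : ℕ) : raiseOp n * raiseOp m - raiseOp m * raiseOp n = 0 := by
  refine Finsupp.lhom_ext' fun x => LinearMap.ext_ring ?_
  simp only [LinearMap.comp_apply, Finsupp.lsingle_apply, LinearMap.sub_apply, Module.End.mul_apply]
  by_cases h : n = m
  · rw [h, sub_self, LinearMap.zero_apply]
  · rw [raiseOp_single, raiseOp_single, map_smul, map_smul, raiseOp_single,
      raiseOp_single, smul_smul, smul_smul, Function.update_of_ne h, Function.update_of_ne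
      (Ne.symm h), Function.update_comm h, mul_comm, sub_self, LinearMap.zero_apply]

/-- The operator of a free generator. The modes `1, 2, …` of the boson algebra are the
positions `0, 1, …` of a sequence. -/
noncomputable def occupationGen : BosonGen → Module.End ℂ OccupationSpace
  | .a n => lowerOp n.natPred
  | .adag n => raiseOp n.natPred

/-- The action of the boson algebra on formal combinations of occupation sequences. -/
noncomputable def occupationHom : BosonAlgebra →ₐ[ℂ] Module.End ℂ OccupationSpace :=
  RingQuot.liftAlgHom ℂ ⟨FreeAlgebra.lift ℂ occupationGen, by
    intro x y h
    cases h with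
    | mixed n m =>
      simp only [map_sub, map_mul, FreeAlgebra.lift_ι_apply, occupationGen,
        lowerOp_raiseOp_commutator, PNat.natPred_inj]
      split_ifs <;> simp
    | annihilation n m =>
      simp only [map_sub, map_mul, FreeAlgebra.lift_ι_apply, occupationGen,
        lowerOp_commutator, map_zero]
    | creation n m =>
      simp only [map_sub, map_mul, FreeAlgebra.lift_ι_apply, occupationGen,
        raiseOp_commutator, map_zero]⟩

theorem occupationHom_gen (g : BosonGen) : occupationHom (BosonAlgebra.gen g) = occupationGen g :=
  (RingQuot.liftAlgHom_mkAlgHom_apply ℂ _ _ (FreeAlgebra.ι ℂ g)).trans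
    (FreeAlgebra.lift_ι_apply _ _)

/-! ### The action spanned by an orthogonal family of occupation vectors -/

section OccupationFamily

variable {H : Type*} [NormedAddCommGroup H] [InnerProductSpace ℂ H]

/-- An orthogonal family of (possibly zero) vectors indexed by the occupation sequences, with
norms that do not change when a quantum is added to a mode. -/
structure IsOccupationFamily (b : (ℕ → ℕ) → H) : Prop where
  orthogonal : ∀ x y, x ≠ y → ⟪b x, b y⟫_ℂ = 0
  norm_update : ∀ x n k, ‖b (Function.update x n k)‖ = ‖b x‖

variable {b : (ℕ → ℕ) → H}

/-- The formal creation operators induce adjoints of the annihilation operators. Both sides are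
nonzero on a pair of sequences only if these differ by one quantum in the mode `n`. -/
theorem IsOccupationFamily.inner_lowerOp (hb : IsOccupationFamily b) (n : ℕ)
    (f g : OccupationSpace) :
    ⟪Finsupp.linearCombination ℂ b (lowerOp n f), Finsupp.linearCombination ℂ b g⟫_ℂ =
      ⟪Finsupp.linearCombination ℂ b f, Finsupp.linearCombination ℂ b (raiseOp n g)⟫_ℂ := by
  have key : ∀ x y : ℕ → ℕ,
      ⟪Finsupp.linearCombination ℂ b (lowerOp n (Finsupp.single x 1)),
        Finsupp.linearCombination ℂ b (Finsupp.single y 1)⟫_ℂ =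
      ⟪Finsupp.linearCombination ℂ b (Finsupp.single x 1),
        Finsupp.linearCombination ℂ b (raiseOp n (Finsupp.single y 1))⟫_ℂ := by
    intro x y
    rw [lowerOp_single, raiseOp_single]
    simp only [map_smul, Finsupp.linearCombination_single, one_smul, inner_smul_left,
      inner_smul_right, Complex.conj_ofReal]
    by_cases h : x = Function.update y n (y n + 1)
    · subst h
      simp [inner_self_eq_norm_sq_to_K, hb.norm_update]
    · rw [hb.orthogonal _ _ h, mul_zero]
      rcases Nat.eq_zero_or_pos (x n) with h0 | h0
      · simp [h0]
      · rw [hb.orthogonal _ _, mul_zero]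
        rintro rfl
        apply h
        simp [Nat.sub_add_cancel h0]
  induction f using Finsupp.induction_linear with
  | zero => simp
  | add f₁ f₂ h₁ h₂ => simp only [map_add, inner_add_left, h₁, h₂]
  | single x c =>
    have hx : Finsupp.single x c = c • Finsupp.single x (1 : ℂ) := by simp
    rw [hx]
    simp only [map_smul, inner_smul_left]
    congr 1
    induction g using Finsupp.induction_linear with
    | zero => simp
    | add f₁ f₂ h₁ h₂ => simp only [map_add, inner_add_right, h₁, h₂]
    | single y d =>
      have hy : Finsupp.single y d = d • Finsupp.single y (1 : ℂ) := by simp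
      rw [hy]
      simp only [map_smul, inner_smul_right]
      rw [key]

theorem IsOccupationFamily.inner_occupationHom (hb : IsOccupationFamily b) (x : BosonAlgebra)
    (f g : OccupationSpace) :
    ⟪Finsupp.linearCombination ℂ b (occupationHom x f), Finsupp.linearCombination ℂ b g⟫_ℂ =
      ⟪Finsupp.linearCombination ℂ b f,
        Finsupp.linearCombination ℂ b (occupationHom (star x) g)⟫_ℂ := by
  induction x using BosonAlgebra.induction generalizing f g with
  | hg y =>
    rw [BosonAlgebra.star_gen, occupationHom_gen, occupationHom_gen]
    cases y with
    | a n => exact hb.inner_lowerOp _ f g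
    | adag n =>
      rw [← inner_conj_symm, ← inner_conj_symm (Finsupp.linearCombination ℂ b f)]
      exact congrArg _ (hb.inner_lowerOp n.natPred g f).symm
  | hs c =>
    simp only [BosonAlgebra.star_algebraMap, AlgHom.commutes, Module.algebraMap_end_apply, map_smul,
      inner_smul_left, inner_smul_right]
  | hm x y hx hy =>
    simp only [star_mul, map_mul, Module.End.mul_apply]
    rw [hx, hy]
  | ha x y hx hy =>
    simp only [star_add, map_add, LinearMap.add_apply, inner_add_left, inner_add_right, hx, hy]

/-- The kernel of `f ↦ ∑ f x • b x` is invariant, since its elements are characterized by being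
orthogonal to the range. -/
theorem IsOccupationFamily.linearCombination_occupationHom_congr (hb : IsOccupationFamily b)
    (x : BosonAlgebra) {f g : OccupationSpace}
    (h : Finsupp.linearCombination ℂ b f = Finsupp.linearCombination ℂ b g) :
    Finsupp.linearCombination ℂ b (occupationHom x f) =
      Finsupp.linearCombination ℂ b (occupationHom x g) := by
  rw [← sub_eq_zero, ← map_sub, ← map_sub, ← inner_self_eq_zero (𝕜 := ℂ), hb.inner_occupationHom,
    map_sub, h, sub_self, inner_zero_left]

/-- The formal action descends to the span of an occupation family. -/
theorem IsOccupationFamily.exists_bosonAction (hb : IsOccupationFamily b) :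
    ∃ η : BosonAction (Submodule.span ℂ (Set.range b)),
      ∀ (x : BosonAlgebra) (f : OccupationSpace) (v : Submodule.span ℂ (Set.range b)),
        (v : H) = Finsupp.linearCombination ℂ b f →
          (η.toHom x v : H) = Finsupp.linearCombination ℂ b (occupationHom x f) := by
  rw [← Finsupp.range_linearCombination]
  set Φ := Finsupp.linearCombination ℂ b with hΦ
  obtain ⟨g, hg⟩ := Φ.rangeRestrict.exists_rightInverse_of_surjective Φ.range_rangeRestrict
  have hg' : ∀ v : LinearMap.range Φ, Φ (g v) = v := fun v =>
    congrArg Subtype.val (LinearMap.congr_fun hg v)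
  let L : BosonAlgebra → Module.End ℂ (LinearMap.range Φ) := fun x =>
    Φ.rangeRestrict ∘ₗ occupationHom x ∘ₗ g
  have hL : ∀ (x : BosonAlgebra) (f : OccupationSpace) (v : LinearMap.range Φ),
      (v : H) = Φ f → (L x v : H) = Φ (occupationHom x f) := fun x f v h =>
    hb.linearCombination_occupationHom_congr x ((hg' v).trans h)
  refine ⟨⟨AlgHom.ofLinearMap ⟨⟨L, ?_⟩, ?_⟩ ?_ ?_, ?_⟩, hL⟩
  · intro x y
    ext v
    simp [L]
  · intro c x
    ext v
    simp [L]
  · ext v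
    exact (hL 1 _ v (hg' v).symm).trans (by simp [hg'])
  · intro x y
    ext v
    refine (hL _ _ v (hg' v).symm).trans ?_
    rw [map_mul, Module.End.mul_apply]
    exact (hL x _ _ (hL y _ v (hg' v).symm)).symm
  · intro x v w
    change ⟪(L x v : H), (w : H)⟫_ℂ = ⟪(v : H), (L (star x) w : H)⟫_ℂ
    rw [hL x _ v (hg' v).symm, hL (star x) _ w (hg' w).symm]
    nth_rewrite 1 [← hg' w]
    rw [hb.inner_occupationHom, hg']

end OccupationFamily

/-! ### Coded families of vectors -/

section CodedFamily

variable {H : Type*} [NormedAddCommGroup H] [InnerProductSpace ℂ H]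

/-- The family `b`, indexed by all sequences, satisfies `tₘ b(x) = b(m, x 0, x 1, …)`, where the
letter `m ≥ 1` is recorded as the number `m - 1`. Vectors of the family may vanish. -/
def IsCodedFamily (t : ℕ+ → H →L[ℂ] H) (b : (ℕ → ℕ) → H) : Prop :=
  ∀ i x, b (consSeq i x) = t i.succPNat (b x)

variable {t : ℕ+ → H →L[ℂ] H} {b : (ℕ → ℕ) → H}

theorem IsCodedFamily.eq_apply_shiftSeq (hb : IsCodedFamily t b) (x : ℕ → ℕ) :
    b x = t (x 0).succPNat (b (shiftSeq x)) := by
  rw [← hb, consSeq_shiftSeq]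

theorem eq_zero_of_dense_span {ι : Type*} {b : ι → H}
    (hd : Dense (Submodule.span ℂ (Set.range b) : Set H)) {v : H} (h : ∀ x, ⟪b x, v⟫_ℂ = 0) :
    v = 0 := by
  refine hd.eq_zero_of_inner_right ℂ fun w hw => ?_
  refine Submodule.span_induction (p := fun w _ => ⟪w, v⟫_ℂ = 0) ?_ (inner_zero_left _) ?_ ?_ hw
  · rintro _ ⟨x, rfl⟩
    exact h x
  · intro x y _ _ hx hy
    rw [inner_add_left, hx, hy, add_zero]
  · intro c x _ hx
    rw [inner_smul_left, hx, mul_zero]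

variable [CompleteSpace H]

/-- The operators `tₘ` are isometries with mutually orthogonal ranges. -/
def IsCuntzFamily (t : ℕ+ → H →L[ℂ] H) : Prop :=
  ∀ i j, star (t i) * t j = if i = j then 1 else 0

theorem IsCuntzFamily.star_apply (ht : IsCuntzFamily t) (i j : ℕ+) (v : H) :
    star (t i) (t j v) = if i = j then v else 0 := by
  have h := congrArg (fun T : H →L[ℂ] H => T v) (ht i j)
  refine Eq.trans h ?_
  split_ifs <;> rfl

theorem IsCuntzFamily.inner_apply (ht : IsCuntzFamily t) (i j : ℕ+) (v w : H) :
    ⟪t i v, t j w⟫_ℂ = if i = j then ⟪v, w⟫_ℂ else 0 := by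
  rw [← ContinuousLinearMap.adjoint_inner_right, ← ContinuousLinearMap.star_eq_adjoint,
    ht.star_apply]
  split_ifs
  · rfl
  · exact inner_zero_right _

theorem IsCuntzFamily.norm_apply (ht : IsCuntzFamily t) (i : ℕ+) (v : H) : ‖t i v‖ = ‖v‖ := by
  rw [← sq_eq_sq₀ (norm_nonneg _) (norm_nonneg _), ← Complex.ofReal_inj]
  push_cast
  have h := ht.inner_apply i i v v
  rw [if_pos rfl, inner_self_eq_norm_sq_to_K, inner_self_eq_norm_sq_to_K] at h
  exact h

theorem IsCodedFamily.star_apply (hb : IsCodedFamily t b) (ht : IsCuntzFamily t) (m : ℕ+)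
    (x : ℕ → ℕ) : star (t m) (b x) = if x 0 = m.natPred then b (shiftSeq x) else 0 := by
  rw [hb.eq_apply_shiftSeq, ht.star_apply]
  refine if_congr ?_ rfl rfl
  constructor
  · rintro rfl; simp
  · intro h; rw [h, PNat.succPNat_natPred]

/-- Distinct sequences differ at some first place, and the common initial letters act
isometrically. -/
theorem IsCodedFamily.orthogonal (hb : IsCodedFamily t b) (ht : IsCuntzFamily t) {x y : ℕ → ℕ}
    (h : x ≠ y) : ⟪b x, b y⟫_ℂ = 0 := by
  obtain ⟨n, hn⟩ := Function.ne_iff.mp h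
  clear h
  induction n generalizing x y with
  | zero =>
    rw [hb.eq_apply_shiftSeq x, hb.eq_apply_shiftSeq y, ht.inner_apply, if_neg]
    exact fun h => hn (Nat.succPNat_injective h)
  | succ n ih =>
    rw [hb.eq_apply_shiftSeq x, hb.eq_apply_shiftSeq y, ht.inner_apply]
    split_ifs
    · exact ih hn
    · rfl

theorem IsCodedFamily.norm_update (hb : IsCodedFamily t b) (ht : IsCuntzFamily t) (x : ℕ → ℕ)
    (n k : ℕ) : ‖b (Function.update x n k)‖ = ‖b x‖ := by
  induction n generalizing x with
  | zero => rw [update_zero_eq_consSeq, hb, ht.norm_apply, hb.eq_apply_shiftSeq x, ht.norm_apply]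
  | succ n ih =>
    rw [update_succ_eq_consSeq, hb, ht.norm_apply, ih, hb.eq_apply_shiftSeq x, ht.norm_apply]

theorem IsCodedFamily.isOccupationFamily (hb : IsCodedFamily t b) (ht : IsCuntzFamily t) :
    IsOccupationFamily b :=
  ⟨fun _ _ h => hb.orthogonal ht h, hb.norm_update ht⟩

/-! ### The recursive boson system on a coded family -/

/-- On `b x` the series for `A₁` has at most one nonzero term: the first letter of the word is
`x 0 + 1`, so only `m = x 0` contributes, and no `m ≥ 1` does so if `x 0 = 0`. -/
theorem IsCodedFamily.rbsOne_linearCombination (hb : IsCodedFamily t b) (ht : IsCuntzFamily t)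
    (f : OccupationSpace) :
    rbsOne t (Finsupp.linearCombination ℂ b f) =
      Finsupp.linearCombination ℂ b (lowerOp 0 f) := by
  refine HasSum.tsum_eq ?_
  induction f using Finsupp.induction_linear with
  | zero => simp
  | add f g hf hg => simpa only [map_add, smul_add] using hf.add hg
  | single x c =>
    have hx : Finsupp.single x c = c • Finsupp.single x (1 : ℂ) := by simp
    have h1 : HasSum (fun m : ℕ+ => ((√(m : ℝ) : ℝ) : ℂ) • t m (star (t (m + 1)) (b x)))
        (((√(x 0 : ℝ) : ℝ) : ℂ) • b (Function.update x 0 (x 0 - 1))) := by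
      have hz : ∀ m : ℕ+, x 0 ≠ m →
          ((√(m : ℝ) : ℝ) : ℂ) • t m (star (t (m + 1)) (b x)) = 0 := by
        intro m hm
        rw [hb.star_apply ht, if_neg, map_zero, smul_zero]
        simpa [PNat.natPred] using hm
      rcases Nat.eq_zero_or_pos (x 0) with h0 | h0
      · rw [h0, Nat.cast_zero, Real.sqrt_zero, Complex.ofReal_zero, zero_smul]
        convert hasSum_zero with m
        exact hz m (by rw [h0]; exact m.pos.ne)
      · let k : ℕ+ := ⟨x 0, h0⟩
        have hk : ((√(x 0 : ℝ) : ℝ) : ℂ) • b (Function.update x 0 (x 0 - 1)) =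
            ((√(k : ℝ) : ℝ) : ℂ) • t k (star (t (k + 1)) (b x)) := by
          rw [hb.star_apply ht, if_pos, update_zero_eq_consSeq, hb]
          · congr 3
            exact PNat.succPNat_natPred k
          · rw [PNat.natPred, PNat.add_coe, PNat.one_coe, Nat.add_sub_cancel]; rfl
        rw [hk]
        refine hasSum_single k fun m hm => hz m fun h => hm ?_
        exact PNat.eq h.symm
    rw [hx]
    simp only [map_smul, lowerOp_single, Finsupp.linearCombination_single, one_smul]
    simpa only [smul_comm _ c] using h1.const_smul c

/-- The formal counterpart of `tₘ*`: it deletes the first term of a sequence if this is the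
letter `m`. -/
noncomputable def tailOp (m : ℕ+) : Module.End ℂ OccupationSpace :=
  Finsupp.linearCombination ℂ fun x =>
    if x 0 = m.natPred then Finsupp.single (shiftSeq x) (1 : ℂ) else 0

theorem IsCodedFamily.star_apply_linearCombination (hb : IsCodedFamily t b) (ht : IsCuntzFamily t)
    (m : ℕ+) (f : OccupationSpace) :
    star (t m) (Finsupp.linearCombination ℂ b f) =
      Finsupp.linearCombination ℂ b (tailOp m f) := by
  induction f using Finsupp.induction_linear with
  | zero => simp
  | add f g hf hg => simp only [map_add, hf, hg]
  | single x c =>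
    rw [tailOp, Finsupp.linearCombination_single, Finsupp.linearCombination_single, map_smul,
      hb.star_apply ht, map_smul]
    split_ifs <;> simp

/-- Conjugation by the first letter of the word moves the annihilation of the mode `k` of the
shifted sequence to the mode `k + 1`. -/
theorem IsCodedFamily.rbsRho_iterate_linearCombination (hb : IsCodedFamily t b)
    (ht : IsCuntzFamily t) (k : ℕ) (f : OccupationSpace) :
    (rbsRho t)^[k] (rbsOne t) (Finsupp.linearCombination ℂ b f) =
      Finsupp.linearCombination ℂ b (lowerOp k f) := by
  induction k generalizing f with
  | zero => exact hb.rbsOne_linearCombination ht f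
  | succ k ih =>
    rw [Function.iterate_succ_apply', rbsRho]
    simp only [hb.star_apply_linearCombination ht, ih]
    refine HasSum.tsum_eq ?_
    induction f using Finsupp.induction_linear with
    | zero => simp
    | add f g hf hg => simpa only [map_add] using hf.add hg
    | single x c =>
      have hx : Finsupp.single x c = c • Finsupp.single x (1 : ℂ) := by simp
      rw [hx]
      simp only [map_smul]
      refine HasSum.const_smul c ?_
      have hs : Finsupp.linearCombination ℂ b (lowerOp (k + 1) (Finsupp.single x 1)) =
          t (x 0).succPNat (Finsupp.linearCombination ℂ b
            (lowerOp k (tailOp (x 0).succPNat (Finsupp.single x 1)))) := by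
        simp only [tailOp, Finsupp.linearCombination_single, Nat.natPred_succPNat, if_true,
          one_smul, lowerOp_single, map_smul, shiftSeq_apply]
        rw [update_succ_eq_consSeq, hb]
      rw [hs]
      refine hasSum_single _ fun m hm => ?_
      rw [tailOp, Finsupp.linearCombination_single, one_smul, if_neg, map_zero, map_zero, map_zero]
      intro h
      rw [h, PNat.succPNat_natPred] at hm
      exact hm rfl

theorem IsCodedFamily.rbs_linearCombination (hb : IsCodedFamily t b) (ht : IsCuntzFamily t)
    (n : ℕ+) (f : OccupationSpace) :
    rbs t n (Finsupp.linearCombination ℂ b f) =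
      Finsupp.linearCombination ℂ b (lowerOp n.natPred f) :=
  hb.rbsRho_iterate_linearCombination ht n.natPred f

end CodedFamily

/-! ### Occupation actions -/

section OccupationAction

variable {H : Type*} [NormedAddCommGroup H] [InnerProductSpace ℂ H]

/-- The action `η` on the span of the vectors `b x` is the image of the formal action on
combinations of occupation sequences. -/
structure IsOccupationAction {D : Submodule ℂ H} (η : BosonAction D) (b : (ℕ → ℕ) → H) :
    Prop where
  isOccupationFamily : IsOccupationFamily b
  span_eq : D = Submodule.span ℂ (Set.range b)
  toHom_eq : ∀ (x : BosonAlgebra) (f : OccupationSpace) (v : D),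
    (v : H) = Finsupp.linearCombination ℂ b f →
      (η.toHom x v : H) = Finsupp.linearCombination ℂ b (occupationHom x f)

theorem BosonAction.toHom_star_eq_of_toHom_eq {D : Submodule ℂ H} {η η' : BosonAction D}
    {x : BosonAlgebra} (h : η.toHom x = η'.toHom x) : η.toHom (star x) = η'.toHom (star x) := by
  refine LinearMap.ext fun v => ext_inner_left ℂ fun w => ?_
  rw [← η.adjoint_eq, ← η'.adjoint_eq, h]

/-- An action is determined by the annihilation operators: their adjoints are determined on the
domain by the inner product. -/
theorem BosonAction.eq_of_toHom_a_eq {D : Submodule ℂ H} {η η' : BosonAction D}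
    (h : ∀ n, η.toHom (BosonAlgebra.a n) = η'.toHom (BosonAlgebra.a n)) : η = η' := by
  refine BosonAction.ext (AlgHom.ext fun x => ?_)
  induction x using BosonAlgebra.induction with
  | hg g =>
    cases g with
    | a n => exact h n
    | adag n =>
      rw [← BosonAlgebra.star_a]
      exact toHom_star_eq_of_toHom_eq (h n)
  | hs c => rw [AlgHom.commutes, AlgHom.commutes]
  | hm x y hx hy => rw [map_mul, map_mul, hx, hy]
  | ha x y hx hy => rw [map_add, map_add, hx, hy]

end OccupationAction

section Restriction

variable {O : Type*} [CStarAlgebra O]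
variable {H : Type u} [NormedAddCommGroup H] [InnerProductSpace ℂ H] [CompleteSpace H]
variable {s : ℕ+ → O} {π : O →⋆ₐ[ℂ] (H →L[ℂ] H)}

theorem IsCuntzGenerators.isCuntzFamily (hs : IsCuntzGenerators s)
    (π : O →⋆ₐ[ℂ] (H →L[ℂ] H)) : IsCuntzFamily fun m => π (s m) := by
  intro i j
  rw [← map_star, ← map_mul, hs.star_mul]
  split_ifs
  · exact map_one π
  · exact map_zero π

theorem IsRestriction.unique {D : Submodule ℂ H} {η η' : BosonAction D}
    (h : IsRestriction s π η) (h' : IsRestriction s π η') : η = η' :=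
  BosonAction.eq_of_toHom_a_eq fun n => LinearMap.ext fun v =>
    Subtype.ext ((h n v).trans (h' n v).symm)

theorem IsCodedFamily.exists_isRestriction {b : (ℕ → ℕ) → H} (hs : IsCuntzGenerators s)
    (hb : IsCodedFamily (fun m => π (s m)) b) {D : Submodule ℂ H}
    (hD : D = Submodule.span ℂ (Set.range b)) :
    ∃ η : BosonAction D, IsRestriction s π η ∧ IsOccupationAction η b := by
  subst hD
  have ht := hs.isCuntzFamily π
  obtain ⟨η, hη⟩ := (hb.isOccupationFamily ht).exists_bosonAction
  refine ⟨η, fun n v => ?_, hb.isOccupationFamily ht, rfl, hη⟩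
  obtain ⟨f, hf⟩ : ∃ f : OccupationSpace, Finsupp.linearCombination ℂ b f = v :=
    Finsupp.mem_span_range_iff_exists_finsupp.mp v.2
  rw [← hf, hb.rbs_linearCombination ht, hη _ f v hf.symm, BosonAlgebra.a, occupationHom_gen]
  rfl

/-- The restriction of a permutative representation acts by the occupation number formulas. -/
theorem IsRestriction.isOccupationAction {b : (ℕ → ℕ) → H} (hs : IsCuntzGenerators s)
    (hb : IsCodedFamily (fun m => π (s m)) b) {D : Submodule ℂ H}
    (hD : D = Submodule.span ℂ (Set.range b)) {η : BosonAction D} (hη : IsRestriction s π η) :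
    IsOccupationAction η b := by
  obtain ⟨η', h, h'⟩ := hb.exists_isRestriction hs hD
  rwa [hη.unique h]

/-! ### Reference subspaces -/

theorem IsReferenceSubspace.dense {D : Submodule ℂ H} (hD : IsReferenceSubspace s π D) :
    Dense (D : Set H) := by
  obtain ⟨Λ, e, f, -, rfl⟩ := hD
  rw [dense_iff_closure_eq, ← Submodule.topologicalClosure_coe, e.dense_span, Submodule.top_coe]

/-- A subspace invariant under all `sₘ` and `sₘ*` that contains a cyclic vector is dense. -/
theorem dense_of_invariant (hs : IsCuntzGenerators s) {K : Submodule ℂ H} {Ω : H} (hΩ : Ω ∈ K)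
    (hcyc : Dense (Set.range fun y : O => π y Ω)) (h : ∀ m, ∀ v ∈ K, π (s m) v ∈ K)
    (h' : ∀ m, ∀ v ∈ K, π (star (s m)) v ∈ K) : Dense (K : Set H) := by
  have hadj : ∀ y ∈ StarAlgebra.adjoin ℂ (Set.range s),
      (∀ v ∈ K, π y v ∈ K) ∧ (∀ v ∈ K, π (star y) v ∈ K) := by
    intro y hy
    induction hy using StarAlgebra.adjoin_induction with
    | mem y hy =>
      obtain ⟨m, rfl⟩ := hy
      exact ⟨h m, h' m⟩
    | algebraMap c =>
      refine ⟨fun v hv => ?_, fun v hv => ?_⟩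
      · simpa [Algebra.algebraMap_eq_smul_one] using K.smul_mem c hv
      · simpa [Algebra.algebraMap_eq_smul_one] using K.smul_mem (starRingEnd ℂ c) hv
    | add x y _ _ hx hy =>
      refine ⟨fun v hv => ?_, fun v hv => ?_⟩
      · simpa using K.add_mem (hx.1 v hv) (hy.1 v hv)
      · simpa using K.add_mem (hx.2 v hv) (hy.2 v hv)
    | mul x y _ _ hx hy =>
      refine ⟨fun v hv => ?_, fun v hv => ?_⟩
      · simpa using hx.1 _ (hy.1 v hv)
      · simpa using hy.2 _ (hx.2 v hv)
    | star x _ hx => exact ⟨hx.2, by simpa using hx.1⟩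
  have hcont : Continuous fun y : O => π y Ω := by
    have hπ : Continuous π :=
      AddMonoidHomClass.continuous_of_bound π 1 fun y => by
        rw [one_mul]; exact NonUnitalStarAlgHom.norm_apply_le π y
    fun_prop
  have hsub : Set.range (fun y : O => π y Ω) ⊆ closure (K : Set H) := by
    rintro _ ⟨y, rfl⟩
    have hy : y ∈ closure (StarAlgebra.adjoin ℂ (Set.range s) : Set O) := by
      rw [← StarSubalgebra.topologicalClosure_coe, hs.generates]
      trivial
    exact map_mem_closure (f := fun y : O => π y Ω) hcont hy fun z hz => (hadj z hz).1 Ω hΩ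
  exact dense_closure.mp (hcyc.mono hsub)

theorem IsCodedFamily.dense_span {b : (ℕ → ℕ) → H} (hs : IsCuntzGenerators s)
    (hb : IsCodedFamily (fun m => π (s m)) b) {Ω : H}
    (hcyc : Dense (Set.range fun y : O => π y Ω)) (hΩ : Ω ∈ Set.range b) :
    Dense (Submodule.span ℂ (Set.range b) : Set H) := by
  refine dense_of_invariant hs (Submodule.subset_span hΩ) hcyc (fun m v hv => ?_)
    (fun m v hv => ?_)
  · refine Submodule.span_induction (fun x hx => ?_) (by simp)
      (fun x y _ _ hx hy => by simpa using Submodule.add_mem _ hx hy)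
      (fun c x _ hx => by simpa using Submodule.smul_mem _ c hx) hv
    obtain ⟨y, rfl⟩ := hx
    refine Submodule.subset_span ⟨consSeq m.natPred y, ?_⟩
    rw [hb, PNat.succPNat_natPred]
  · refine Submodule.span_induction (fun x hx => ?_) (by simp)
      (fun x y _ _ hx hy => by simpa using Submodule.add_mem _ hx hy)
      (fun c x _ hx => by simpa using Submodule.smul_mem _ c hx) hv
    obtain ⟨y, rfl⟩ := hx
    have h := hb.star_apply (hs.isCuntzFamily π) m y
    rw [map_star, h]
    split_ifs
    · exact Submodule.subset_span ⟨_, rfl⟩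
    · exact Submodule.zero_mem _

/-- A reference basis vector `e l` that is not orthogonal to `b x` is orthogonal to all other
`b y`: the isometries `sₘ*` strip common initial letters from `x`, `y` and `e l`. -/
theorem IsCodedFamily.inner_eq_zero_of_inner_ne_zero {b : (ℕ → ℕ) → H} (hs : IsCuntzGenerators s)
    (hb : IsCodedFamily (fun m => π (s m)) b) {Λ : Type*} {e : HilbertBasis Λ ℂ H}
    {f : ℕ+ → Λ → Λ} (hf : ∀ i n, π (s i) (e n) = e (f i n)) {x y : ℕ → ℕ} (h : x ≠ y) (l : Λ)
    (hx : ⟪b x, e l⟫_ℂ ≠ 0) : ⟪b y, e l⟫_ℂ = 0 := by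
  have ht := hs.isCuntzFamily π
  -- Some basis vector is mapped to `e l` by the first letter of `x`.
  have hpre : ∀ (x : ℕ → ℕ) (l : Λ), ⟪b x, e l⟫_ℂ ≠ 0 →
      ∃ k, e l = π (s (x 0).succPNat) (e k) := by
    intro x l hx
    by_contra! hne
    refine hx ?_
    have h0 : star (π (s (x 0).succPNat)) (e l) = 0 := by
      refine eq_zero_of_dense_span (b := e) ?_ fun k => ?_
      · rw [dense_iff_closure_eq, ← Submodule.topologicalClosure_coe, e.dense_span,
          Submodule.top_coe]
      · rw [ContinuousLinearMap.star_eq_adjoint, ContinuousLinearMap.adjoint_inner_right, hf]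
        refine e.orthonormal.2 fun hk => hne k ?_
        rw [hf, hk]
    rw [hb.eq_apply_shiftSeq, ← ContinuousLinearMap.adjoint_inner_right,
      ← ContinuousLinearMap.star_eq_adjoint, h0, inner_zero_right]
  obtain ⟨n, hn⟩ := Function.ne_iff.mp h
  clear h
  induction n generalizing x y l with
  | zero =>
    obtain ⟨k, hk⟩ := hpre x l hx
    rw [hk, hb.eq_apply_shiftSeq y]
    refine (ht.inner_apply _ _ _ _).trans (if_neg fun h => hn ?_)
    exact (Nat.succPNat_injective h).symm
  | succ n ih =>
    obtain ⟨k, hk⟩ := hpre x l hx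
    rw [hk, hb.eq_apply_shiftSeq x] at hx
    rw [hk, hb.eq_apply_shiftSeq y]
    have hi := fun i j v w => ht.inner_apply i j v w
    rw [hi, if_pos rfl] at hx
    rw [hi]
    split_ifs
    · exact ih k hx hn
    · rfl

/-- Every reference subspace is the span of the coded family: each reference basis vector is a
multiple of some `b x`, and each `b x ≠ 0` is a multiple of a reference basis vector. -/
theorem IsReferenceSubspace.eq_span {b : (ℕ → ℕ) → H} (hs : IsCuntzGenerators s)
    (hb : IsCodedFamily (fun m => π (s m)) b)
    (hd : Dense (Submodule.span ℂ (Set.range b) : Set H)) {D : Submodule ℂ H}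
    (hD : IsReferenceSubspace s π D) : D = Submodule.span ℂ (Set.range b) := by
  obtain ⟨Λ, e, f, hf, rfl⟩ := hD
  have key : ∀ x l, ⟪b x, e l⟫_ℂ ≠ 0 → ∃ c : ℂ, c ≠ 0 ∧ e l = c • b x := by
    intro x l hx
    have hbx : ⟪b x, b x⟫_ℂ ≠ 0 := by
      intro h0
      rw [inner_self_eq_zero.mp h0, inner_zero_left] at hx
      exact hx rfl
    refine ⟨⟪b x, e l⟫_ℂ / ⟪b x, b x⟫_ℂ, div_ne_zero hx hbx, ?_⟩
    rw [← sub_eq_zero]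
    refine eq_zero_of_dense_span hd fun y => ?_
    rw [inner_sub_right, inner_smul_right]
    by_cases hxy : x = y
    · rw [← hxy, div_mul_cancel₀ _ hbx, sub_self]
    · rw [hb.inner_eq_zero_of_inner_ne_zero hs hf hxy l hx,
        hb.orthogonal (hs.isCuntzFamily π) (Ne.symm hxy), mul_zero, sub_self]
  apply le_antisymm
  · rw [Submodule.span_le]
    rintro _ ⟨l, rfl⟩
    obtain ⟨x, hx⟩ : ∃ x, ⟪b x, e l⟫_ℂ ≠ 0 := by
      by_contra! h
      exact e.orthonormal.ne_zero l (eq_zero_of_dense_span hd h)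
    obtain ⟨c, -, hc⟩ := key x l hx
    rw [hc]
    exact Submodule.smul_mem _ _ (Submodule.subset_span ⟨x, rfl⟩)
  · rw [Submodule.span_le]
    rintro _ ⟨x, rfl⟩
    by_cases h0 : b x = 0
    · rw [h0]; exact Submodule.zero_mem _
    obtain ⟨l, hl⟩ : ∃ l, ⟪b x, e l⟫_ℂ ≠ 0 := by
      by_contra! h
      refine h0 (eq_zero_of_dense_span (b := e) ?_ fun l => ?_)
      · rw [dense_iff_closure_eq, ← Submodule.topologicalClosure_coe, e.dense_span,
          Submodule.top_coe]
      · rw [← inner_conj_symm, h, map_zero]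
    obtain ⟨c, hc0, hc⟩ := key x l hl
    have : b x = c⁻¹ • e l := by rw [hc, smul_smul, inv_mul_cancel₀ hc0, one_smul]
    rw [this]
    exact Submodule.smul_mem _ _ (Submodule.subset_span ⟨l, rfl⟩)

/-- The normalized nonzero members of a coded family form a reference basis. The index set is lifted
to the universe of `H`, as required by the definition of a reference subspace. -/
theorem IsCodedFamily.isPermutative {b : (ℕ → ℕ) → H} (hs : IsCuntzGenerators s)
    (hb : IsCodedFamily (fun m => π (s m)) b)
    (hd : Dense (Submodule.span ℂ (Set.range b) : Set H)) : IsPermutative s π := by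
  have ht := hs.isCuntzFamily π
  have hnorm : ∀ i x, ‖b (consSeq i x)‖ = ‖b x‖ := fun i x => by
    rw [hb]; exact ht.norm_apply _ _
  let Λ := ULift.{u} {x : ℕ → ℕ // b x ≠ 0}
  let v : Λ → H := fun l => ((‖b l.down.1‖ : ℂ)⁻¹) • b l.down.1
  have hv : Orthonormal ℂ v := by
    refine ⟨fun l => ?_, fun l k hlk => ?_⟩
    · simp only [v]
      exact norm_smul_inv_norm l.down.2
    · simp only [v]
      rw [inner_smul_left, inner_smul_right, hb.orthogonal ht, mul_zero, mul_zero]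
      exact fun h => hlk (ULift.ext _ _ (Subtype.ext h))
  have hspan : ⊤ ≤ (Submodule.span ℂ (Set.range v)).topologicalClosure := by
    rw [top_le_iff, ← Submodule.dense_iff_topologicalClosure_eq_top]
    refine hd.mono ?_
    rw [SetLike.coe_subset_coe, Submodule.span_le]
    rintro _ ⟨x, rfl⟩
    by_cases h0 : b x = 0
    · rw [h0]; exact Submodule.zero_mem _
    have : b x = (‖b x‖ : ℂ) • v ⟨⟨x, h0⟩⟩ := by
      simp only [v]
      rw [smul_smul, mul_inv_cancel₀, one_smul]
      simpa using h0
    rw [this]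
    exact Submodule.smul_mem _ _ (Submodule.subset_span ⟨_, rfl⟩)
  refine ⟨_, Λ, HilbertBasis.mk hv hspan, fun i l => ⟨⟨consSeq i.natPred l.down.1, ?_⟩⟩, ?_, rfl⟩
  · rw [← norm_ne_zero_iff, hnorm, norm_ne_zero_iff]
    exact l.down.2
  · intro i l
    rw [HilbertBasis.coe_mk]
    simp only [v]
    rw [map_smul, hnorm, hb, PNat.succPNat_natPred]

end Restriction

/-! ### Coded families from fixed vectors -/

section FixedVector

variable {H : Type*} [NormedAddCommGroup H] [InnerProductSpace ℂ H]

/-- The word `x 0, …, x (N - 1)` applied to `v`, where the number `i` stands for the letter `i + 1`. -/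
def wordApply (t : ℕ+ → H →L[ℂ] H) : ℕ → (ℕ → ℕ) → H → H
  | 0, _, v => v
  | N + 1, x, v => t (x 0).succPNat (wordApply t N (shiftSeq x) v)

/-- Prolonging a word into its tail does not change the vector that it produces. -/
theorem wordApply_succ_eq {t : ℕ+ → H →L[ℂ] H} {P : Set (ℕ → ℕ)} {β : (ℕ → ℕ) → H}
    (hβ : ∀ y ∈ P, β y = t (y 0).succPNat (β (shiftSeq y))) {N : ℕ} {x : ℕ → ℕ}
    (hx : shiftSeq^[N] x ∈ P) :
    wordApply t (N + 1) x (β (shiftSeq^[N + 1] x)) = wordApply t N x (β (shiftSeq^[N] x)) := by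
  induction N generalizing x with
  | zero => exact (hβ x hx).symm
  | succ N ih =>
    rw [wordApply, Function.iterate_succ_apply, ih hx]
    rfl

theorem wordApply_add_eq {t : ℕ+ → H →L[ℂ] H} {P : Set (ℕ → ℕ)} {β : (ℕ → ℕ) → H}
    (hP : ∀ y ∈ P, shiftSeq y ∈ P)
    (hβ : ∀ y ∈ P, β y = t (y 0).succPNat (β (shiftSeq y))) {N : ℕ} {x : ℕ → ℕ}
    (hx : shiftSeq^[N] x ∈ P) (k : ℕ) :
    wordApply t (N + k) x (β (shiftSeq^[N + k] x)) = wordApply t N x (β (shiftSeq^[N] x)) ∧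
      shiftSeq^[N + k] x ∈ P := by
  induction k with
  | zero => exact ⟨rfl, hx⟩
  | succ k ih =>
    refine ⟨(wordApply_succ_eq hβ ih.2).trans ih.1, ?_⟩
    rw [← add_assoc, Function.iterate_succ_apply']
    exact hP _ ih.2

/-- Vectors `β y` attached to the members `y` of a shift-invariant set and compatible with the
isometries extend to a coded family that is supported on the sequences with a tail in this set. -/
theorem exists_isCodedFamily {t : ℕ+ → H →L[ℂ] H} {P : Set (ℕ → ℕ)} {β : (ℕ → ℕ) → H}
    (hP : ∀ y ∈ P, shiftSeq y ∈ P)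
    (hβ : ∀ y ∈ P, β y = t (y 0).succPNat (β (shiftSeq y))) :
    ∃ b, IsCodedFamily t b ∧ (∀ y ∈ P, b y = β y) ∧
      ∀ x, b x ≠ 0 → ∃ N, shiftSeq^[N] x ∈ P := by
  classical
  let b : (ℕ → ℕ) → H := fun x =>
    if h : ∃ N, shiftSeq^[N] x ∈ P then wordApply t h.choose x (β (shiftSeq^[h.choose] x)) else 0
  have hb : ∀ (N : ℕ) (x : ℕ → ℕ), shiftSeq^[N] x ∈ P →
      b x = wordApply t N x (β (shiftSeq^[N] x)) := by
    intro N x hx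
    have h : ∃ N, shiftSeq^[N] x ∈ P := ⟨N, hx⟩
    simp only [b]
    rw [dif_pos h, ← (wordApply_add_eq hP hβ hx h.choose).1,
      ← (wordApply_add_eq hP hβ h.choose_spec N).1, add_comm]
  have hb0 : ∀ x : ℕ → ℕ, (¬ ∃ N, shiftSeq^[N] x ∈ P) → b x = 0 := fun x hx => dif_neg hx
  refine ⟨b, fun i x => ?_, fun y hy => hb 0 y hy, fun x hx => ?_⟩
  · by_cases h : ∃ N, shiftSeq^[N] x ∈ P
    · obtain ⟨N, hN⟩ := h
      rw [hb N x hN, hb (N + 1) (consSeq i x) hN]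
      rfl
    · rw [hb0 x h, hb0, map_zero]
      rintro ⟨N, hN⟩
      refine h ⟨N, ?_⟩
      have := hP _ hN
      rwa [← Function.iterate_succ_apply' shiftSeq N, Function.iterate_succ_apply] at this
  · by_contra h
    exact hx (hb0 x h)

end FixedVector

/-! ### Irreducible constituents: sequences with a common tail -/

/-- The sequences that agree with `q` from some place on. -/
def tailClass (q : ℕ → ℕ) : Set (ℕ → ℕ) := {x | ∃ N, ∀ n ≥ N, x n = q n}

theorem self_mem_tailClass (q : ℕ → ℕ) : q ∈ tailClass q := ⟨0, fun _ _ => rfl⟩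

theorem update_mem_tailClass {q x : ℕ → ℕ} (hx : x ∈ tailClass q) (n k : ℕ) :
    Function.update x n k ∈ tailClass q := by
  obtain ⟨N, hN⟩ := hx
  refine ⟨max N (n + 1), fun m hm => ?_⟩
  rw [Function.update_of_ne (by omega)]
  exact hN m (by omega)

/-- A tail class is generated from any of its members by changing one term at a time. -/
theorem tailClass_induction {q : ℕ → ℕ} {p : (ℕ → ℕ) → Prop} (h0 : p q)
    (h : ∀ x n k, p x → p (Function.update x n k)) : ∀ x ∈ tailClass q, p x := by
  rintro x ⟨N, hN⟩
  induction N generalizing x with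
  | zero =>
    have : x = q := funext fun n => hN n (Nat.zero_le n)
    rwa [this]
  | succ N ih =>
    have := h _ N (x N) (ih (Function.update x N (q N)) fun n hn => ?_)
    · rwa [Function.update_idem, Function.update_eq_self] at this
    · rcases eq_or_ne n N with rfl | hne
      · simp
      · rw [Function.update_of_ne hne]
        exact hN n (by omega)

section TailClass

variable {H : Type*} [NormedAddCommGroup H] [InnerProductSpace ℂ H]
variable {D : Submodule ℂ H} {η : BosonAction D} {b : (ℕ → ℕ) → H}

theorem IsOccupationAction.mem (hη : IsOccupationAction η b) (x : ℕ → ℕ) : b x ∈ D := by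
  rw [hη.span_eq]
  exact Submodule.subset_span ⟨x, rfl⟩

theorem IsOccupationAction.toHom_apply (hη : IsOccupationAction η b) (y : BosonAlgebra)
    (x : ℕ → ℕ) : (η.toHom y ⟨b x, hη.mem x⟩ : H) =
      Finsupp.linearCombination ℂ b (occupationHom y (Finsupp.single x 1)) :=
  hη.toHom_eq y _ _ (by simp)

theorem IsOccupationAction.toHom_a (hη : IsOccupationAction η b) (n : ℕ+) (x : ℕ → ℕ) :
    η.toHom (BosonAlgebra.a n) ⟨b x, hη.mem x⟩ = ((√(x n.natPred : ℝ) : ℝ) : ℂ) •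
      ⟨b (Function.update x n.natPred (x n.natPred - 1)), hη.mem _⟩ := by
  refine Subtype.ext ((hη.toHom_apply _ _).trans ?_)
  rw [BosonAlgebra.a, occupationHom_gen, occupationGen, lowerOp_single]
  simp

theorem IsOccupationAction.toHom_star_a (hη : IsOccupationAction η b) (n : ℕ+) (x : ℕ → ℕ) :
    η.toHom (star (BosonAlgebra.a n)) ⟨b x, hη.mem x⟩ = ((√(x n.natPred + 1 : ℝ) : ℝ) : ℂ) •
      ⟨b (Function.update x n.natPred (x n.natPred + 1)), hη.mem _⟩ := by
  refine Subtype.ext ((hη.toHom_apply _ _).trans ?_)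
  rw [BosonAlgebra.star_a, occupationHom_gen, occupationGen, raiseOp_single]
  simp

theorem IsOccupationAction.toHom_a_mul_star_a (hη : IsOccupationAction η b) (n : ℕ+)
    (x : ℕ → ℕ) : η.toHom (BosonAlgebra.a n * star (BosonAlgebra.a n)) ⟨b x, hη.mem x⟩ =
      ((x n.natPred : ℂ) + 1) • ⟨b x, hη.mem x⟩ := by
  refine Subtype.ext ((hη.toHom_apply _ _).trans ?_)
  rw [map_mul, BosonAlgebra.star_a, BosonAlgebra.a, occupationHom_gen, occupationHom_gen,
    Module.End.mul_apply]
  refine (congrArg _ (lowerOp_mul_raiseOp_single _ _)).trans ?_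
  rw [map_smul, Finsupp.linearCombination_single, one_smul]
  rfl

theorem IsOccupationAction.toHom_star_a_mul_a (hη : IsOccupationAction η b) (n : ℕ+)
    (x : ℕ → ℕ) : η.toHom (star (BosonAlgebra.a n) * BosonAlgebra.a n) ⟨b x, hη.mem x⟩ =
      (x n.natPred : ℂ) • ⟨b x, hη.mem x⟩ := by
  refine Subtype.ext ((hη.toHom_apply _ _).trans ?_)
  rw [map_mul, BosonAlgebra.star_a, BosonAlgebra.a, occupationHom_gen, occupationHom_gen,
    Module.End.mul_apply]
  refine (congrArg _ (raiseOp_mul_lowerOp_single _ _)).trans ?_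
  simp

/-- The span of the vectors `b x` with `x` in the tail class of `q`. -/
def tailSpan (b : (ℕ → ℕ) → H) (q : ℕ → ℕ) : Submodule ℂ H :=
  Submodule.span ℂ (b '' tailClass q)

theorem mem_tailSpan (b : (ℕ → ℕ) → H) (q : ℕ → ℕ) : b q ∈ tailSpan b q :=
  Submodule.subset_span ⟨q, self_mem_tailClass q, rfl⟩

theorem tailSpan_le_span (b : (ℕ → ℕ) → H) (q : ℕ → ℕ) :
    tailSpan b q ≤ Submodule.span ℂ (Set.range b) :=
  Submodule.span_mono (Set.image_subset_range _ _)

theorem span_eq_tailSpan {b : (ℕ → ℕ) → H} {q : ℕ → ℕ} (h : ∀ x, b x ≠ 0 → x ∈ tailClass q) :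
    Submodule.span ℂ (Set.range b) = tailSpan b q := by
  refine le_antisymm (Submodule.span_le.mpr ?_) (tailSpan_le_span b q)
  rintro _ ⟨x, rfl⟩
  by_cases h0 : b x = 0
  · rw [h0]; exact Submodule.zero_mem _
  · exact Submodule.subset_span ⟨x, h x h0, rfl⟩

theorem span_eq_tailSpan_sup {b : (ℕ → ℕ) → H} {q r : ℕ → ℕ}
    (h : ∀ x, b x ≠ 0 → x ∈ tailClass q ∨ x ∈ tailClass r) :
    tailSpan b q ⊔ tailSpan b r = Submodule.span ℂ (Set.range b) := by
  refine le_antisymm (sup_le (tailSpan_le_span b q) (tailSpan_le_span b r))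
    (Submodule.span_le.mpr ?_)
  rintro _ ⟨x, rfl⟩
  by_cases h0 : b x = 0
  · rw [h0]; exact Submodule.zero_mem _
  · rcases h x h0 with hx | hx
    · exact Submodule.mem_sup_left (Submodule.subset_span ⟨x, hx, rfl⟩)
    · exact Submodule.mem_sup_right (Submodule.subset_span ⟨x, hx, rfl⟩)

theorem mem_tailClass_of_mem_of_mem {q r x : ℕ → ℕ} (hq : x ∈ tailClass q) (hr : x ∈ tailClass r) :
    q ∈ tailClass r := by
  obtain ⟨N, hN⟩ := hq
  obtain ⟨M, hM⟩ := hr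
  exact ⟨max N M, fun n hn => by rw [← hN n (by omega), hM n (by omega)]⟩

theorem isOrtho_tailSpan {b : (ℕ → ℕ) → H} {q r : ℕ → ℕ}
    (hb : ∀ x y, x ≠ y → ⟪b x, b y⟫_ℂ = 0) (h : q ∉ tailClass r) :
    tailSpan b q ⟂ tailSpan b r := by
  refine Submodule.isOrtho_span.mpr ?_
  rintro _ ⟨x, hx, rfl⟩ _ ⟨y, hy, rfl⟩
  refine hb x y ?_
  rintro rfl
  exact h (mem_tailClass_of_mem_of_mem hx hy)

theorem IsOccupationAction.tailSpan_le (hη : IsOccupationAction η b) (q : ℕ → ℕ) :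
    tailSpan b q ≤ D := by
  rw [tailSpan, Submodule.span_le]
  rintro _ ⟨x, -, rfl⟩
  exact hη.mem x

theorem IsOccupationAction.toHom_mem_tailSpan (hη : IsOccupationAction η b) (q : ℕ → ℕ)
    (y : BosonAlgebra) (v : D) (hv : (v : H) ∈ tailSpan b q) :
    (η.toHom y v : H) ∈ tailSpan b q := by
  induction y using BosonAlgebra.induction generalizing v with
  | hg g =>
    obtain ⟨v, hvD⟩ := v
    change v ∈ _ at hv
    induction hv using Submodule.span_induction with
    | mem w hw =>
      obtain ⟨x, hx, rfl⟩ := hw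
      cases g with
      | a n =>
        rw [← BosonAlgebra.a, hη.toHom_a]
        exact Submodule.smul_mem _ _ (Submodule.subset_span
          ⟨_, update_mem_tailClass hx _ _, rfl⟩)
      | adag n =>
        rw [← BosonAlgebra.star_a, hη.toHom_star_a]
        exact Submodule.smul_mem _ _ (Submodule.subset_span
          ⟨_, update_mem_tailClass hx _ _, rfl⟩)
    | zero =>
      have : (⟨0, hvD⟩ : D) = 0 := rfl
      rw [this, map_zero]
      exact Submodule.zero_mem _
    | add v w hv hw ihv ihw =>
      have hv' := hη.tailSpan_le q hv
      have hw' := hη.tailSpan_le q hw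
      have : (⟨v + w, hvD⟩ : D) = ⟨v, hv'⟩ + ⟨w, hw'⟩ := rfl
      rw [this, map_add]
      exact Submodule.add_mem _ (ihv hv') (ihw hw')
    | smul c v hv ihv =>
      have hv' := hη.tailSpan_le q hv
      have : (⟨c • v, hvD⟩ : D) = c • ⟨v, hv'⟩ := rfl
      rw [this, map_smul]
      exact Submodule.smul_mem _ _ (ihv hv')
  | hs c =>
    rw [AlgHom.commutes, Module.algebraMap_end_apply]
    exact Submodule.smul_mem _ _ hv
  | hm x y hx hy =>
    rw [map_mul]
    exact hx _ (hy _ hv)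
  | ha x y hx hy =>
    rw [map_add]
    exact Submodule.add_mem _ (hx _ hv) (hy _ hv)

/-- The vector `b q` generates all `b x` in its tail class: creation and annihilation operators
change one occupation number by one, with coefficients that do not vanish. -/
theorem IsOccupationAction.exists_toHom_eq (hη : IsOccupationAction η b) (q : ℕ → ℕ) (v : D)
    (hv : (v : H) ∈ tailSpan b q) : ∃ y, η.toHom y ⟨b q, hη.mem q⟩ = v := by
  have hup : ∀ (x : ℕ → ℕ) (n : ℕ), (∃ y, η.toHom y ⟨b q, hη.mem q⟩ = ⟨b x, hη.mem x⟩) →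
      ∃ y, η.toHom y ⟨b q, hη.mem q⟩ = ⟨b (Function.update x n (x n + 1)), hη.mem _⟩ := by
    rintro x n ⟨y, hy⟩
    have h0 : ((√(x n + 1 : ℝ) : ℝ) : ℂ) ≠ 0 := by
      rw [Complex.ofReal_ne_zero]
      positivity
    refine ⟨((√(x n + 1 : ℝ) : ℝ) : ℂ)⁻¹ • (star (BosonAlgebra.a n.succPNat) * y), ?_⟩
    rw [map_smul, map_mul, LinearMap.smul_apply, Module.End.mul_apply, hy, hη.toHom_star_a,
      Nat.natPred_succPNat, smul_smul, inv_mul_cancel₀ h0, one_smul]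
  have hdown : ∀ (x : ℕ → ℕ) (n : ℕ), x n ≠ 0 →
      (∃ y, η.toHom y ⟨b q, hη.mem q⟩ = ⟨b x, hη.mem x⟩) →
      ∃ y, η.toHom y ⟨b q, hη.mem q⟩ = ⟨b (Function.update x n (x n - 1)), hη.mem _⟩ := by
    rintro x n hn ⟨y, hy⟩
    have h0 : ((√(x n : ℝ) : ℝ) : ℂ) ≠ 0 := by
      rw [Complex.ofReal_ne_zero, Real.sqrt_ne_zero (by positivity)]
      exact_mod_cast hn
    refine ⟨((√(x n : ℝ) : ℝ) : ℂ)⁻¹ • (BosonAlgebra.a n.succPNat * y), ?_⟩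
    rw [map_smul, map_mul, LinearMap.smul_apply, Module.End.mul_apply, hy, hη.toHom_a,
      Nat.natPred_succPNat, smul_smul, inv_mul_cancel₀ h0, one_smul]
  have hzero : ∀ (k : ℕ) (x : ℕ → ℕ) (n : ℕ), x n = k →
      (∃ y, η.toHom y ⟨b q, hη.mem q⟩ = ⟨b x, hη.mem x⟩) →
      ∃ y, η.toHom y ⟨b q, hη.mem q⟩ = ⟨b (Function.update x n 0), hη.mem _⟩ := by
    intro k
    induction k with
    | zero =>
      intro x n hk hx
      simpa only [← hk, Function.update_eq_self] using hx
    | succ k ih =>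
      intro x n hk hx
      have h := ih (Function.update x n (x n - 1)) n (by simp [hk])
        (hdown x n (by omega) hx)
      simpa only [Function.update_idem] using h
  -- An arbitrary change of one occupation number: lower it to `0`, then raise it.
  have hall : ∀ (k : ℕ) (x : ℕ → ℕ) (n : ℕ),
      (∃ y, η.toHom y ⟨b q, hη.mem q⟩ = ⟨b x, hη.mem x⟩) →
      ∃ y, η.toHom y ⟨b q, hη.mem q⟩ = ⟨b (Function.update x n k), hη.mem _⟩ := by
    intro k x n hx
    induction k with
    | zero => exact hzero _ x n rfl hx
    | succ k ih =>
      have h := hup _ n ih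
      simpa only [Function.update_idem, Function.update_self] using h
  have hbasis : ∀ x ∈ tailClass q, ∃ y, η.toHom y ⟨b q, hη.mem q⟩ = ⟨b x, hη.mem x⟩ :=
    tailClass_induction (p := fun x => ∃ y, η.toHom y ⟨b q, hη.mem q⟩ = ⟨b x, hη.mem x⟩)
      ⟨1, by rw [map_one, Module.End.one_apply]⟩ fun x n k => hall k x n
  obtain ⟨v, hvD⟩ := v
  change v ∈ _ at hv
  induction hv using Submodule.span_induction with
  | mem w hw =>
    obtain ⟨x, hx, rfl⟩ := hw
    exact hbasis x hx
  | zero => exact ⟨0, by rw [map_zero]; rfl⟩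
  | add v w hv hw ihv ihw =>
    obtain ⟨y, hy⟩ := ihv (hη.tailSpan_le q hv)
    obtain ⟨z, hz⟩ := ihw (hη.tailSpan_le q hw)
    exact ⟨y + z, by rw [map_add, LinearMap.add_apply, hy, hz]; rfl⟩
  | smul c v hv ihv =>
    obtain ⟨y, hy⟩ := ihv (hη.tailSpan_le q hv)
    exact ⟨c • y, by rw [map_smul, LinearMap.smul_apply, hy]; rfl⟩

/-- The action restricted to an invariant subspace of its domain. -/
noncomputable def BosonAction.restrict (η : BosonAction D) {V : Submodule ℂ H} (hV : V ≤ D)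
    (hinv : ∀ (y : BosonAlgebra) (v : D), (v : H) ∈ V → (η.toHom y v : H) ∈ V) :
    BosonAction V where
  toHom := AlgHom.ofLinearMap
    { toFun := fun y =>
        { toFun := fun v => ⟨η.toHom y (Submodule.inclusion hV v), hinv y _ v.2⟩
          map_add' := fun v w => by ext; simp
          map_smul' := fun c v => by ext; simp }
      map_add' := fun x y => by ext; simp
      map_smul' := fun c x => by ext; simp }
    (by ext; simp) (fun x y => LinearMap.ext fun v => Subtype.ext
      (congrArg (fun w : D => (w : H))
        (LinearMap.congr_fun (map_mul η.toHom x y) (Submodule.inclusion hV v))))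
  adjoint_eq y v w := η.adjoint_eq y (Submodule.inclusion hV v) (Submodule.inclusion hV w)

theorem BosonAction.isSubaction_restrict (η : BosonAction D) {V : Submodule ℂ H} (hV : V ≤ D)
    (hinv : ∀ (y : BosonAlgebra) (v : D), (v : H) ∈ V → (η.toHom y v : H) ∈ V) :
    (η.restrict hV hinv).IsSubaction η :=
  ⟨hV, fun _ _ => rfl⟩

theorem BosonAction.IsSubaction.toHom_eq_iff {V : Submodule ℂ H} {η' : BosonAction V}
    (h : η'.IsSubaction η) {v w : V} {y : BosonAlgebra} :
    η'.toHom y v = w ↔ η.toHom y ⟨v, h.choose v.2⟩ = ⟨w, h.choose w.2⟩ := by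
  rw [Subtype.ext_iff, Subtype.ext_iff, h.choose_spec]
  rfl

/-! ### Irreducibility and inequivalence -/

/-- An action generated by a vector `b q ≠ 0`, on the span of joint eigenvectors `b x` of the
number operators whose occupation sequences `x` have the tail of `q`. -/
structure IsTailAction {V : Submodule ℂ H} (η : BosonAction V) (b : (ℕ → ℕ) → H)
    (q : ℕ → ℕ) : Prop where
  ne_zero : b q ≠ 0
  orthogonal : ∀ x y, x ≠ y → ⟪b x, b y⟫_ℂ = 0
  span_eq : V = tailSpan b q
  number : ∀ (n : ℕ+) (x : ℕ → ℕ) (h : b x ∈ V), x ∈ tailClass q →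
    η.toHom (star (BosonAlgebra.a n) * BosonAlgebra.a n) ⟨b x, h⟩ =
      (x n.natPred : ℂ) • ⟨b x, h⟩
  cyclic : ∀ h : b q ∈ V, η.IsCyclicVector ⟨b q, h⟩

theorem IsOccupationAction.isTailAction (hη : IsOccupationAction η b) {V : Submodule ℂ H}
    {η' : BosonAction V} (h : η'.IsSubaction η) {q : ℕ → ℕ} (hV : V = tailSpan b q)
    (hq : b q ≠ 0) : IsTailAction η' b q where
  ne_zero := hq
  orthogonal := hη.isOccupationFamily.orthogonal
  span_eq := hV
  number n x hx _ := by
    rw [h.toHom_eq_iff]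
    exact hη.toHom_star_a_mul_a n x
  cyclic hq v := by
    obtain ⟨y, hy⟩ := hη.exists_toHom_eq q ⟨v, h.choose v.2⟩ (by rw [← hV]; exact v.2)
    exact ⟨y, h.toHom_eq_iff.mpr hy⟩

/-- A subaction generated by `b q` lives on the tail span of `q`. -/
theorem IsOccupationAction.eq_tailSpan (hη : IsOccupationAction η b) {V : Submodule ℂ H}
    {η' : BosonAction V} (h : η'.IsSubaction η) {q : ℕ → ℕ} {Ω : H} (hΩ : b q = Ω) (hq : Ω ∈ V)
    (hcyc : η'.IsCyclicVector ⟨Ω, hq⟩) : V = tailSpan b q := by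
  subst hΩ
  refine le_antisymm (fun v hv => ?_) fun v hv => ?_
  · obtain ⟨y, hy⟩ := hcyc ⟨v, hv⟩
    rw [h.toHom_eq_iff] at hy
    have := hη.toHom_mem_tailSpan q y ⟨b q, hη.mem q⟩ (mem_tailSpan b q)
    rwa [hy] at this
  · obtain ⟨y, hy⟩ := hη.exists_toHom_eq q ⟨v, hη.tailSpan_le q hv⟩ hv
    have h1 := h.choose_spec y ⟨b q, hq⟩
    have h2 : (η.toHom y ⟨b q, hη.mem q⟩ : H) = v := congrArg Subtype.val hy
    rw [← h2]
    exact h1 ▸ (η'.toHom y ⟨b q, hq⟩).2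

variable {q : ℕ → ℕ}

theorem IsTailAction.mem (hη : IsTailAction η b q) {x : ℕ → ℕ} (hx : x ∈ tailClass q) :
    b x ∈ D := by
  rw [hη.span_eq]
  exact Submodule.subset_span ⟨x, hx, rfl⟩

theorem inner_eq_zero_of_forall_tailClass {v : H} (h : ∀ x ∈ tailClass q, ⟪b x, v⟫_ℂ = 0) {w : H}
    (hw : w ∈ tailSpan b q) : ⟪w, v⟫_ℂ = 0 := by
  induction hw using Submodule.span_induction with
  | mem w hw =>
    obtain ⟨x, hx, rfl⟩ := hw
    exact h x hx
  | zero => exact inner_zero_left _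
  | add x y _ _ hx hy => rw [inner_add_left, hx, hy, add_zero]
  | smul c x _ hx => rw [inner_smul_left, hx, mul_zero]

theorem BosonAction.inner_number {D : Submodule ℂ H} (η : BosonAction D) (n : ℕ+) (v w : D) :
    ⟪η.toHom (star (BosonAlgebra.a n) * BosonAlgebra.a n) v, w⟫_ℂ =
      ⟪v, η.toHom (star (BosonAlgebra.a n) * BosonAlgebra.a n) w⟫_ℂ := by
  rw [η.adjoint_eq, star_mul, star_star]

/-- Joint eigenvalues of the number operators occur only for sequences in the tail class. -/
theorem IsTailAction.eq_zero_of_number_eq (hη : IsTailAction η b q) {r : ℕ → ℕ}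
    (hr : r ∉ tailClass q) {v : D}
    (hv : ∀ n : ℕ+, η.toHom (star (BosonAlgebra.a n) * BosonAlgebra.a n) v =
      (r n.natPred : ℂ) • v) : v = 0 := by
  have h : ∀ x ∈ tailClass q, ⟪b x, (v : H)⟫_ℂ = 0 := by
    intro x hx
    have hne : x ≠ r := by rintro rfl; exact hr hx
    obtain ⟨n, hn⟩ := Function.ne_iff.mp hne
    have h1 := η.inner_number n.succPNat ⟨b x, hη.mem hx⟩ v
    rw [hη.number _ _ _ hx, hv, inner_smul_left, inner_smul_right, Nat.natPred_succPNat,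
      map_natCast] at h1
    refine (mul_eq_zero.mp ?_).resolve_left
      (sub_ne_zero.mpr (Nat.cast_injective.ne hn : (x n : ℂ) ≠ r n))
    rw [sub_mul]
    exact sub_eq_zero.mpr h1
  have h2 := inner_eq_zero_of_forall_tailClass h (hη.span_eq.le v.2)
  exact Subtype.ext (inner_self_eq_zero.mp h2)

theorem IsTailAction.not_unitarilyEquivalent {H' : Type*} [NormedAddCommGroup H']
    [InnerProductSpace ℂ H'] {D' : Submodule ℂ H'} {η' : BosonAction D'} {b' : (ℕ → ℕ) → H'}
    {q' : ℕ → ℕ} (hη : IsTailAction η b q) (hη' : IsTailAction η' b' q')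
    (hq : q ∉ tailClass q') : ¬ η.UnitarilyEquivalent η' := by
  rintro ⟨U, hU⟩
  have hmem := hη.mem (self_mem_tailClass q)
  have h0 : U ⟨b q, hmem⟩ = 0 := hη'.eq_zero_of_number_eq hq fun n => by
    rw [← hU, hη.number _ _ _ (self_mem_tailClass q), map_smul]
  rw [map_eq_zero_iff U U.injective] at h0
  exact hη.ne_zero (congrArg Subtype.val h0)

/-- A member of the commutant maps the generating joint eigenvector `b q` to a multiple of itself,
because the joint eigenspace is one-dimensional; the commutation relation does the rest. -/
theorem IsTailAction.isIrreducible (hη : IsTailAction η b q) : η.IsIrreducible := by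
  have hdense : Dense (Set.range (BosonAction.incl D)) := by
    intro v
    rw [closure_subtype, ← Set.range_comp]
    have : Set.range (Subtype.val ∘ BosonAction.incl D) = (D : Set H) := by
      ext w
      exact ⟨fun ⟨z, hz⟩ => hz ▸ z.2, fun hw => ⟨⟨w, hw⟩, rfl⟩⟩
    rw [this]
    exact v.2
  have hinner : ∀ v w : D, ⟪BosonAction.incl D v, BosonAction.incl D w⟫_ℂ = ⟪v, w⟫_ℂ :=
    fun v w => rfl
  apply Set.Subset.antisymm
  · intro T hT
    have hqD := hη.mem (self_mem_tailClass q)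
    set Ω : D := ⟨b q, hqD⟩ with hΩ
    have hΩ0 : ⟪Ω, Ω⟫_ℂ ≠ 0 := by
      rw [inner_self_ne_zero]
      exact fun h => hη.ne_zero (congrArg Subtype.val h)
    set c : ℂ := ⟪BosonAction.incl D Ω, T (BosonAction.incl D Ω)⟫_ℂ / ⟪Ω, Ω⟫_ℂ with hc
    have hTΩ : T (BosonAction.incl D Ω) = c • BosonAction.incl D Ω := by
      rw [← sub_eq_zero]
      have hx : ∀ x ∈ tailClass q,
          ⟪b x, ((T (BosonAction.incl D Ω) - c • BosonAction.incl D Ω :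
            D.topologicalClosure) : H)⟫_ℂ = 0 := by
        intro x hx
        change ⟪BosonAction.incl D ⟨b x, hη.mem hx⟩,
          T (BosonAction.incl D Ω) - c • BosonAction.incl D Ω⟫_ℂ = 0
        rw [inner_sub_right, inner_smul_right, hinner]
        rcases eq_or_ne x q with rfl | hne
        · rw [hc, div_mul_cancel₀ _ hΩ0, sub_self]
        · have h0 : ⟪(⟨b x, hη.mem hx⟩ : D), Ω⟫_ℂ = 0 := hη.orthogonal x q hne
          rw [h0, mul_zero, sub_zero]
          obtain ⟨n, hn⟩ := Function.ne_iff.mp hne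
          have h1 := hT (star (BosonAlgebra.a n.succPNat) * BosonAlgebra.a n.succPNat) Ω
            ⟨b x, hη.mem hx⟩
          rw [star_mul, star_star, hη.number _ _ _ (self_mem_tailClass q), hη.number _ _ _ hx,
            map_smul, map_smul, map_smul, inner_smul_left, inner_smul_right, Nat.natPred_succPNat,
            map_natCast] at h1
          refine (mul_eq_zero.mp ?_).resolve_left
            (sub_ne_zero.mpr (Nat.cast_injective.ne hn.symm : (q n : ℂ) ≠ x n))
          rw [sub_mul]
          exact sub_eq_zero.mpr h1
      refine hdense.eq_zero_of_inner_right ℂ ?_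
      rintro _ ⟨w, rfl⟩
      exact inner_eq_zero_of_forall_tailClass hx (hη.span_eq.le w.2)
    refine ⟨c, ContinuousLinearMap.ext fun v => ?_⟩
    refine congrFun (Continuous.ext_on hdense (ContinuousLinearMap.continuous _) T.continuous ?_) v
    rintro _ ⟨v, rfl⟩
    obtain ⟨y, rfl⟩ := hη.cyclic hqD v
    refine hdense.eq_of_inner_right ℂ ?_
    rintro _ ⟨w, rfl⟩
    rw [hT y Ω w, hTΩ, inner_smul_right, hinner, η.adjoint_eq, star_star]
    exact inner_smul_right _ _ _
  · rintro _ ⟨c, rfl⟩ y v w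
    simp only [smul_apply, ContinuousLinearMap.id_apply, inner_smul_right,
      hinner]
    rw [η.adjoint_eq, star_star]

end TailClass

/-! ### The representations with a fixed vector of `s_j` or of `s₁s₂` -/

/-- The occupation sequence of the generating vector of each of the named representations: the
infinite words `jjj…`, `1212…` and `2121…`, with letters shifted by one. -/
def etaSeq : EtaLabel → ℕ → ℕ
  | .single j => fun _ => j.natPred
  | .onetwo => fun n => n % 2
  | .twoone => fun n => (n + 1) % 2

theorem etaSeq_notMem_tailClass {X Y : EtaLabel} (h : X ≠ Y) : etaSeq X ∉ tailClass (etaSeq Y) := by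
  rintro ⟨N, hN⟩
  have h0 := hN (2 * N) (by omega)
  have h1 := hN (2 * N + 1) (by omega)
  cases X <;> cases Y <;> simp only [etaSeq] at h0 h1 <;>
    first | exact h rfl | omega | exact h (congrArg _ (PNat.natPred_injective h0))

section Fixed

variable {O : Type*} [CStarAlgebra O]
variable {H : Type u} [NormedAddCommGroup H] [InnerProductSpace ℂ H] [CompleteSpace H]
variable {s : ℕ+ → O} {π : O →⋆ₐ[ℂ] (H →L[ℂ] H)} {Ω : H}

theorem exists_isCodedFamily_single {j : ℕ+} (h : π (s j) Ω = Ω) :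
    ∃ b, IsCodedFamily (fun m => π (s m)) b ∧ b (etaSeq (.single j)) = Ω ∧
      ∀ x, b x ≠ 0 → x ∈ tailClass (etaSeq (.single j)) := by
  obtain ⟨b, hb, hbΩ, hsupp⟩ := exists_isCodedFamily (t := fun m => π (s m))
    (P := {etaSeq (.single j)}) (β := fun _ => Ω) (by rintro y rfl; rfl) (by
      rintro y rfl
      simp only [etaSeq, PNat.succPNat_natPred, h])
  refine ⟨b, hb, hbΩ _ rfl, fun x hx => ?_⟩
  obtain ⟨N, hN⟩ := hsupp x hx
  refine ⟨N, fun n hn => ?_⟩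
  have := congrFun hN (n - N)
  rwa [shiftSeq_iterate_apply, Nat.sub_add_cancel hn] at this

/-- The shift exchanges the two words `1212…` and `2121…`, which stand for `Ω` and `s₂Ω`. -/
theorem exists_isCodedFamily_onetwo (h : π (s 1 * s 2) Ω = Ω) :
    ∃ b, IsCodedFamily (fun m => π (s m)) b ∧ b (etaSeq .onetwo) = Ω ∧
      b (etaSeq .twoone) = π (s 2) Ω ∧
      ∀ x, b x ≠ 0 → x ∈ tailClass (etaSeq .onetwo) ∨ x ∈ tailClass (etaSeq .twoone) := by
  obtain ⟨b, hb, hbΩ, hsupp⟩ := exists_isCodedFamily (t := fun m => π (s m))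
    (P := {etaSeq .onetwo, etaSeq .twoone})
    (β := fun y => if y 0 = 0 then Ω else π (s 2) Ω) (by
      rintro y (rfl | rfl)
      · exact Or.inr rfl
      · refine Or.inl (funext fun n => ?_)
        simp only [etaSeq, shiftSeq_apply]
        omega) (by
      rintro y (rfl | rfl)
      · rw [map_mul] at h
        exact h.symm
      · rfl)
  refine ⟨b, hb, hbΩ _ (Or.inl rfl), hbΩ _ (Or.inr rfl), fun x hx => ?_⟩
  obtain ⟨N, hN⟩ := hsupp x hx
  have hx : ∀ n ≥ N, x n = shiftSeq^[N] x (n - N) := fun n hn => by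
    rw [shiftSeq_iterate_apply, Nat.sub_add_cancel hn]
  -- The parity of the position where the tail begins decides between the two classes.
  rcases hN with hN | hN <;> rw [hN] at hx <;> rcases Nat.mod_two_eq_zero_or_one N with h2 | h2
  · exact Or.inl ⟨N, fun n hn => by rw [hx n hn]; simp only [etaSeq]; omega⟩
  · exact Or.inr ⟨N, fun n hn => by rw [hx n hn]; simp only [etaSeq]; omega⟩
  · exact Or.inr ⟨N, fun n hn => by rw [hx n hn]; simp only [etaSeq]; omega⟩
  · exact Or.inl ⟨N, fun n hn => by rw [hx n hn]; simp only [etaSeq]; omega⟩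

/-- Each named representation is generated by a joint eigenvector of the number operators, whose
occupation sequence depends on the name only. -/
theorem IsEta.exists_isTailAction (hs : IsCuntzGenerators s) {X : EtaLabel} {V : Submodule ℂ H}
    {η : BosonAction V} (h : IsEta s X η) : ∃ b, IsTailAction η b (etaSeq X) := by
  cases X with
  | single j =>
    obtain ⟨π, Ω, ⟨hΩ, hcyc, hfix⟩, hD, hη⟩ := h
    obtain ⟨b, hb, hbΩ, hsupp⟩ := exists_isCodedFamily_single hfix
    have hspan := hD.eq_span hs hb (hb.dense_span hs hcyc ⟨_, hbΩ⟩)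
    refine ⟨b, (hη.isOccupationAction hs hb hspan).isTailAction (η' := η) ⟨le_rfl, fun _ _ => rfl⟩
      (hspan.trans (span_eq_tailSpan hsupp)) ?_⟩
    rwa [hbΩ]
  | onetwo =>
    obtain ⟨π, Ω, ⟨hΩ, hcyc, hfix⟩, D, θ, hD, hθ, hsub, hmem, hgen⟩ := h
    obtain ⟨b, hb, hbΩ, -, -⟩ := exists_isCodedFamily_onetwo hfix
    have hspan := hD.eq_span hs hb (hb.dense_span hs hcyc ⟨_, hbΩ⟩)
    have hocc := hθ.isOccupationAction hs hb hspan
    refine ⟨b, hocc.isTailAction hsub (hocc.eq_tailSpan hsub hbΩ hmem hgen) ?_⟩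
    rwa [hbΩ]
  | twoone =>
    obtain ⟨π, Ω, ⟨hΩ, hcyc, hfix⟩, D, θ, hD, hθ, hsub, hmem, hgen⟩ := h
    obtain ⟨b, hb, hbΩ, hbΩ', -⟩ := exists_isCodedFamily_onetwo hfix
    have hspan := hD.eq_span hs hb (hb.dense_span hs hcyc ⟨_, hbΩ⟩)
    have hocc := hθ.isOccupationAction hs hb hspan
    refine ⟨b, hocc.isTailAction hsub (hocc.eq_tailSpan hsub hbΩ' hmem hgen) ?_⟩
    rw [hbΩ', ← norm_ne_zero_iff]
    have hn := (hs.isCuntzFamily π).norm_apply 2 Ω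
    exact hn ▸ norm_ne_zero_iff.mpr hΩ

theorem restriction_of_fixed_single (hs : IsCuntzGenerators s) (j : ℕ+)
    (h : IsCyclicFixed π (s j) Ω) :
    IsPermutative s π ∧
      ∀ D : Submodule ℂ H, IsReferenceSubspace s π D →
        Dense (D : Set H) ∧
        (∃! η : BosonAction D, IsRestriction s π η) ∧
        ∀ η : BosonAction D, IsRestriction s π η → ∃ hΩ : Ω ∈ D,
          η.IsCyclicVector ⟨Ω, hΩ⟩ ∧
          (∀ n : ℕ+, η.toHom (BosonAlgebra.a n * star (BosonAlgebra.a n)) ⟨Ω, hΩ⟩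
            = (j : ℂ) • (⟨Ω, hΩ⟩ : D)) ∧
          (j = 1 → η.IsFock ⟨Ω, hΩ⟩) := by
  obtain ⟨hΩ, hcyc, hfix⟩ := h
  obtain ⟨b, hb, rfl, hsupp⟩ := exists_isCodedFamily_single hfix
  have hd := hb.dense_span hs hcyc ⟨_, rfl⟩
  refine ⟨hb.isPermutative hs hd, fun D hD => ⟨hD.dense, ?_, fun η hη => ?_⟩⟩
  · obtain ⟨η, hη, -⟩ := hb.exists_isRestriction hs (hD.eq_span hs hb hd)
    exact ⟨η, hη, fun η' hη' => hη'.unique hη⟩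
  · have hspan := hD.eq_span hs hb hd
    have hocc := hη.isOccupationAction hs hb hspan
    have hgen : η.IsCyclicVector ⟨b (etaSeq (.single j)), hocc.mem _⟩ := fun v =>
      hocc.exists_toHom_eq _ v ((hspan.trans (span_eq_tailSpan hsupp)).le v.2)
    refine ⟨hocc.mem _, hgen, fun n => ?_, ?_⟩
    · rw [hocc.toHom_a_mul_star_a, etaSeq]
      congr 1
      exact_mod_cast PNat.natPred_add_one j
    · rintro rfl
      refine ⟨fun h => hΩ (congrArg Subtype.val h), hgen, fun n => ?_⟩
      have h0 : etaSeq (.single 1) n.natPred = 0 := rfl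
      rw [hocc.toHom_a, h0, Nat.cast_zero, Real.sqrt_zero, Complex.ofReal_zero, zero_smul]

theorem restriction_of_fixed_onetwo (hs : IsCuntzGenerators s)
    (h : IsCyclicFixed π (s 1 * s 2) Ω) :
    IsPermutative s π ∧
      ∀ D : Submodule ℂ H, IsReferenceSubspace s π D →
        Dense (D : Set H) ∧
        (∃! θ : BosonAction D, IsRestriction s π θ) ∧
        ∀ θ : BosonAction D, IsRestriction s π θ →
          ∃ (V₁ V₂ : Submodule ℂ H) (η₁₂ : BosonAction V₁) (η₂₁ : BosonAction V₂)
            (h₁ : Ω ∈ V₁) (h₂ : π (s 2) Ω ∈ V₂),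
            V₁ ⟂ V₂ ∧ V₁ ⊔ V₂ = D ∧
            η₁₂.IsSubaction θ ∧ η₂₁.IsSubaction θ ∧
            η₁₂.IsCyclicVector ⟨Ω, h₁⟩ ∧ η₂₁.IsCyclicVector ⟨π (s 2) Ω, h₂⟩ ∧
            ∀ n : ℕ+,
              η₁₂.toHom (BosonAlgebra.a (2 * n - 1)) ⟨Ω, h₁⟩ = 0 ∧
              η₂₁.toHom (BosonAlgebra.a (2 * n)) ⟨π (s 2) Ω, h₂⟩ = 0 ∧
              η₁₂.toHom (star (BosonAlgebra.a (2 * n)) * BosonAlgebra.a (2 * n)) ⟨Ω, h₁⟩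
                = ⟨Ω, h₁⟩ ∧
              η₂₁.toHom (star (BosonAlgebra.a (2 * n - 1)) * BosonAlgebra.a (2 * n - 1))
                ⟨π (s 2) Ω, h₂⟩ = ⟨π (s 2) Ω, h₂⟩ := by
  obtain ⟨hΩ, hcyc, hfix⟩ := h
  obtain ⟨b, hb, rfl, hbΩ', hsupp⟩ := exists_isCodedFamily_onetwo hfix
  have hd := hb.dense_span hs hcyc ⟨_, rfl⟩
  refine ⟨hb.isPermutative hs hd, fun D hD => ⟨hD.dense, ?_, fun θ hθ => ?_⟩⟩
  · obtain ⟨η, hη, -⟩ := hb.exists_isRestriction hs (hD.eq_span hs hb hd)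
    exact ⟨η, hη, fun η' hη' => hη'.unique hη⟩
  have hspan := hD.eq_span hs hb hd
  have hocc := hθ.isOccupationAction hs hb hspan
  simp only [← hbΩ']
  have h₁ := θ.isSubaction_restrict (hocc.tailSpan_le (etaSeq .onetwo))
    (hocc.toHom_mem_tailSpan _)
  have h₂ := θ.isSubaction_restrict (hocc.tailSpan_le (etaSeq .twoone))
    (hocc.toHom_mem_tailSpan _)
  -- The mode `2n` is an odd position of the sequence, and `2n - 1` an even one.
  have heven : ∀ n : ℕ+, (2 * n).natPred % 2 = 1 := fun n => by
    have := n.pos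
    rw [PNat.natPred, PNat.mul_coe]
    change (2 * (n : ℕ) - 1) % 2 = 1
    omega
  have hodd : ∀ n : ℕ+, (2 * n - 1).natPred % 2 = 0 := fun n => by
    have h2 : ((2 * n - 1 : ℕ+) : ℕ) = 2 * (n : ℕ) - 1 := by
      rw [PNat.sub_coe, if_pos]
      · rfl
      · rw [← PNat.coe_lt_coe, PNat.mul_coe]
        have := n.pos
        change 1 < 2 * (n : ℕ)
        omega
    rw [PNat.natPred, h2]
    omega
  refine ⟨tailSpan b (etaSeq .onetwo), tailSpan b (etaSeq .twoone), _, _, mem_tailSpan _ _,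
    mem_tailSpan _ _, isOrtho_tailSpan hocc.isOccupationFamily.orthogonal
      (etaSeq_notMem_tailClass (by simp)), (span_eq_tailSpan_sup hsupp).trans hspan.symm, h₁, h₂,
    fun v => ?_, fun v => ?_, fun n => ⟨?_, ?_, ?_, ?_⟩⟩
  · obtain ⟨y, hy⟩ := hocc.exists_toHom_eq _ ⟨v, hocc.tailSpan_le _ v.2⟩ v.2
    exact ⟨y, h₁.toHom_eq_iff.mpr hy⟩
  · obtain ⟨y, hy⟩ := hocc.exists_toHom_eq _ ⟨v, hocc.tailSpan_le _ v.2⟩ v.2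
    exact ⟨y, h₂.toHom_eq_iff.mpr hy⟩
  · rw [h₁.toHom_eq_iff]
    refine (hocc.toHom_a _ _).trans ?_
    simp only [etaSeq, hodd n, Nat.cast_zero, Real.sqrt_zero, Complex.ofReal_zero, zero_smul]
    rfl
  · rw [h₂.toHom_eq_iff]
    refine (hocc.toHom_a _ _).trans ?_
    have h0 : ((2 * n).natPred + 1) % 2 = 0 := by have := heven n; omega
    simp only [etaSeq, h0, Nat.cast_zero, Real.sqrt_zero, Complex.ofReal_zero, zero_smul]
    rfl
  · rw [h₁.toHom_eq_iff]
    refine (hocc.toHom_star_a_mul_a _ _).trans ?_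
    simp only [etaSeq, heven n, Nat.cast_one, one_smul]
  · rw [h₂.toHom_eq_iff]
    refine (hocc.toHom_star_a_mul_a _ _).trans ?_
    have h1 : ((2 * n - 1).natPred + 1) % 2 = 1 := by have := hodd n; omega
    simp only [etaSeq, h1, Nat.cast_one, one_smul]

end Fixed

theorem theorem1p2 {O : Type*} [CStarAlgebra O] (s : ℕ+ → O) (hs : IsCuntzGenerators s) :
    -- (i)
    (∀ {H : Type*} [NormedAddCommGroup H] [InnerProductSpace ℂ H] [CompleteSpace H]
      (π : O →⋆ₐ[ℂ] (H →L[ℂ] H)) (j : ℕ+) (Ω : H), IsCyclicFixed π (s j) Ω →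
      IsPermutative s π ∧
      ∀ D : Submodule ℂ H, IsReferenceSubspace s π D →
        Dense (D : Set H) ∧
        (∃! η : BosonAction D, IsRestriction s π η) ∧
        ∀ η : BosonAction D, IsRestriction s π η → ∃ hΩ : Ω ∈ D,
          η.IsCyclicVector ⟨Ω, hΩ⟩ ∧
          (∀ n : ℕ+, η.toHom (BosonAlgebra.a n * star (BosonAlgebra.a n)) ⟨Ω, hΩ⟩
            = (j : ℂ) • (⟨Ω, hΩ⟩ : D)) ∧
          (j = 1 → η.IsFock ⟨Ω, hΩ⟩)) ∧
    -- (ii)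
    (∀ {H : Type*} [NormedAddCommGroup H] [InnerProductSpace ℂ H] [CompleteSpace H]
      (π : O →⋆ₐ[ℂ] (H →L[ℂ] H)) (Ω : H), IsCyclicFixed π (s 1 * s 2) Ω →
      IsPermutative s π ∧
      ∀ D : Submodule ℂ H, IsReferenceSubspace s π D →
        Dense (D : Set H) ∧
        (∃! θ : BosonAction D, IsRestriction s π θ) ∧
        ∀ θ : BosonAction D, IsRestriction s π θ →
          ∃ (V₁ V₂ : Submodule ℂ H) (η₁₂ : BosonAction V₁) (η₂₁ : BosonAction V₂)
            (h₁ : Ω ∈ V₁) (h₂ : π (s 2) Ω ∈ V₂),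
            V₁ ⟂ V₂ ∧ V₁ ⊔ V₂ = D ∧
            η₁₂.IsSubaction θ ∧ η₂₁.IsSubaction θ ∧
            η₁₂.IsCyclicVector ⟨Ω, h₁⟩ ∧ η₂₁.IsCyclicVector ⟨π (s 2) Ω, h₂⟩ ∧
            ∀ n : ℕ+,
              η₁₂.toHom (BosonAlgebra.a (2 * n - 1)) ⟨Ω, h₁⟩ = 0 ∧
              η₂₁.toHom (BosonAlgebra.a (2 * n)) ⟨π (s 2) Ω, h₂⟩ = 0 ∧
              η₁₂.toHom (star (BosonAlgebra.a (2 * n)) * BosonAlgebra.a (2 * n)) ⟨Ω, h₁⟩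
                = ⟨Ω, h₁⟩ ∧
              η₂₁.toHom (star (BosonAlgebra.a (2 * n - 1)) * BosonAlgebra.a (2 * n - 1))
                ⟨π (s 2) Ω, h₂⟩ = ⟨π (s 2) Ω, h₂⟩) ∧
    -- (iii)
    (∀ {H H' : Type*} [NormedAddCommGroup H] [InnerProductSpace ℂ H] [CompleteSpace H]
      [NormedAddCommGroup H'] [InnerProductSpace ℂ H'] [CompleteSpace H']
      (X Y : EtaLabel) (V : Submodule ℂ H) (V' : Submodule ℂ H')
      (η : BosonAction V) (η' : BosonAction V'),
      X ≠ Y → IsEta s X η → IsEta s Y η' → ¬ η.UnitarilyEquivalent η') ∧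
    -- (iv)
    (∀ {H : Type*} [NormedAddCommGroup H] [InnerProductSpace ℂ H] [CompleteSpace H]
      (X : EtaLabel) (V : Submodule ℂ H) (η : BosonAction V),
      IsEta s X η → η.IsIrreducible) := by
  refine ⟨?_, ?_, ?_, ?_⟩
  · intro H _ _ _ π j Ω h
    exact restriction_of_fixed_single hs j h
  · intro H _ _ _ π Ω h
    exact restriction_of_fixed_onetwo hs h
  · intro H H' _ _ _ _ _ _ X Y V V' η η' hXY hη hη'
    obtain ⟨b, hb⟩ := hη.exists_isTailAction hs
    obtain ⟨b', hb'⟩ := hη'.exists_isTailAction hs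
    exact hb.not_unitarilyEquivalent hb' (etaSeq_notMem_tailClass hXY)
  · intro H _ _ _ X V η hη
    obtain ⟨b, hb⟩ := hη.exists_isTailAction hs
    exact hb.isIrreducible
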